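/- **Conventions.** A Riemann surface is a connected Hausdorff topological space, locally homeomorphic to $\mathbb C$, endowed with a holomorphic atlas (second countability is not assumed). A disk in a Riemann surface $X$ with center $x$ is a set $D=\varphi^{-1}(\mathbb D)$, where $\varphi:U\to\mathbb C$ is a holomorphic chart with $\varphi(x)=0$ and $\overline{\mathbb D}\subset\varphi(U)$, and $\mathbb D$ is the open unit disk. A continuous function $u:X\to\mathbb R$ is called subharmonic, respectively harmonic, if for every such disk the number $$\frac1{2\pi}\int_0^{2\pi}u(\varphi^{-1}(e^{it}))\,dt-u(x)$$ is non-negative, respectively zero. The same definitions are used on open subsets of $X$, with disks given by charts defined inside the open subset. For a disk $D=\varphi^{-1}(\mathbb D)$ and a continuous $u$, let $u^{(D)}$ be the function equal to $u$ on $X\setminus D$ and, at $y\in D$, equal to the Poisson integral $$\frac1{2\pi}\int_0^{2\pi}u(\varphi^{-1}(e^{i\theta}))\,\frac{1-|\varphi(y)|^2}{|e^{i\theta}-\varphi(y)|^2}\,d\theta .$$ A Perron family on $X$ is a set $\mathcal F$ of subharmonic functions on $X$ such that $\max(f,g)\in\mathcal F$ whenever $f,g\in\mathcal F$, and $f^{(D)}\in\mathcal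 F$ for every $f\in\mathcal F$ and every disk $D$ in $X$. It is locally bounded above if every point of $X$ has a neighbourhood $V$ and a constant $C$ with $f\le C$ on $V$ for all $f\in\mathcal F$. A sub-manifold with boundary of $X$ is a subset $Y\subset X$ such that every point of $Y$ lies in the domain $W$ of a real $C^\infty$ chart $\psi:W\to\mathbb C$ of $X$ with $Y\cap W=\{x\in W:\operatorname{Im}\psi(x)\ge 0\}$; its boundary $\partial Y$ consists of the points of $Y$ sent to the real line by such a chart, and $\mathring Y$ denotes the interior of $Y$, that is, $Y\setminus\partial Y$. Neither $Y$ nor $\partial Y$ need be compact, and $\partial Y$ may be empty. **Theorem.** Let $X$ be a (possibly not second countable) Riemann surface. 1. (Perron's principle) If $\mathcal F$ is a non-empty, locally bounded above Perron family on $X$, then the pointwise supremum $\sup_{f\in\mathcal F}f$ is a (finite) harmonic function on $X$. 2. (Dirichlet's principle) Let $Y\subset X$ be a sub-manifold with boundary and let $m\le M$ be real numbers. If $f:\partial Y\to[m,M]$ is continuous, then there exists a continuous function $\tilde f:Y\to[m,M]$ which extends $f$ and is harmonic on $\mathring Y$. -/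

import Mathlib

open scoped Manifold ContDiff

noncomputable section

namespace RiemannSurface

variable {X : Type*} [TopologicalSpace X] [ChartedSpace ℂ X]

/-- A holomorphic chart `φ` of the Riemann surface `X` whose image contains the closed unit disk.
(A complex `C^1` transition map is the same as a holomorphic one.) -/
def IsDiskChart (φ : OpenPartialHomeomorph X ℂ) : Prop :=
  φ ∈ IsManifold.maximalAtlas 𝓘(ℂ) 1 X ∧ Metric.closedBall (0 : ℂ) 1 ⊆ φ.target

/-- The disk in `X` determined by a disk chart: the preimage of the open unit disk. Its center is
`φ.symm 0`. -/
def disk (φ : OpenPartialHomeomorph X ℂ) : Set X :=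
  φ.source ∩ φ ⁻¹' Metric.ball (0 : ℂ) 1

/-- `u` is subharmonic on the open set `U`, regarded as a Riemann surface (its holomorphic charts
are those of `X` with domain inside `U`): `u` is continuous, and for every disk in `U` the value at
the center is at most the average `(2π)⁻¹ ∫ u(e^{it}) dt` over the boundary circle. -/
def IsSubharmonicOn (u : X → ℝ) (U : Set X) : Prop :=
  ContinuousOn u U ∧ ∀ φ : OpenPartialHomeomorph X ℂ, IsDiskChart φ → φ.source ⊆ U →
    0 ≤ Real.circleAverage (u ∘ φ.symm) 0 1 - u (φ.symm 0)

/-- `u` is harmonic on the open set `U`, regarded as a Riemann surface: `u` is continuous, and for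
every disk in `U` the value at the center equals the average over the boundary circle. -/
def IsHarmonicOn (u : X → ℝ) (U : Set X) : Prop :=
  ContinuousOn u U ∧ ∀ φ : OpenPartialHomeomorph X ℂ, IsDiskChart φ → φ.source ⊆ U →
    Real.circleAverage (u ∘ φ.symm) 0 1 - u (φ.symm 0) = 0

/-- A subharmonic function on the whole surface. -/
def IsSubharmonic (u : X → ℝ) : Prop := IsSubharmonicOn u Set.univ

/-- A harmonic function on the whole surface. -/
def IsHarmonic (u : X → ℝ) : Prop := IsHarmonicOn u Set.univ

open Classical in
/-- The function `u^{(D)}` for the disk `D` of the disk chart `φ`: it agrees with `u` outside `D`,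
and inside `D` it is the Poisson integral of the values of `u` on the boundary circle. -/
def poissonModification (φ : OpenPartialHomeomorph X ℂ) (u : X → ℝ) (x : X) : ℝ :=
  if x ∈ disk φ then
    Real.circleAverage (fun ζ : ℂ => poissonKernel 0 (φ x) ζ * u (φ.symm ζ)) 0 1
  else u x

/-- A Perron family: a set of subharmonic functions on `X`, closed under pairwise maxima and under
replacing a function inside a disk by the Poisson integral of its boundary values. -/
structure IsPerronFamily (F : Set (X → ℝ)) : Prop where
  subharmonic : ∀ f ∈ F, IsSubharmonic f
  max_mem : ∀ f ∈ F, ∀ g ∈ F, (fun x => max (f x) (g x)) ∈ F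
  poisson_mem : ∀ f ∈ F, ∀ φ : OpenPartialHomeomorph X ℂ, IsDiskChart φ →
    poissonModification φ f ∈ F

/-- A family of real functions that is uniformly bounded above near every point. -/
def IsLocallyBoundedAbove (F : Set (X → ℝ)) : Prop :=
  ∀ x : X, ∃ V ∈ nhds x, ∃ C : ℝ, ∀ f ∈ F, ∀ y ∈ V, f y ≤ C

/-- `Y` is a (two-dimensional, embedded) sub-manifold with smooth boundary of the surface `X`: near
each of its points there is a real `C^∞` chart of `X` in which `Y` is the closed upper half-plane.
A point of `Y` may be sent into the open upper half-plane, and then it is an interior point. -/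
def IsSubmanifoldWithBoundary (Y : Set X) : Prop :=
  ∀ p ∈ Y, ∃ ψ : OpenPartialHomeomorph X ℂ, ψ ∈ IsManifold.maximalAtlas 𝓘(ℝ, ℂ) ∞ X ∧
    p ∈ ψ.source ∧ ∀ x ∈ ψ.source, (x ∈ Y ↔ 0 ≤ (ψ x).im)

/-- The boundary `∂Y` of a sub-manifold with boundary: the points of `Y` which some smooth chart
straightening `Y` sends to the real line. -/
def boundary (Y : Set X) : Set X :=
  {p | p ∈ Y ∧ ∃ ψ : OpenPartialHomeomorph X ℂ, ψ ∈ IsManifold.maximalAtlas 𝓘(ℝ, ℂ) ∞ X ∧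
    p ∈ ψ.source ∧ (∀ x ∈ ψ.source, (x ∈ Y ↔ 0 ≤ (ψ x).im)) ∧ (ψ p).im = 0}

end RiemannSurface

end

open scoped Manifold ContDiff

noncomputable section

namespace RiemannSurface

open Metric Set Filter Topology Real InnerProductSpace

/-! Subharmonicity is first made local. A continuous function satisfying the submean inequality on
small circles obeys the maximum principle (`nonpos_of_isSubmeanAt`), hence lies below its Poisson
integral on every disk; this is `isSubharmonicOn_iff`. Maxima and Poisson modifications are then
subharmonic because, where they are not already harmonic, a subharmonic function touches them from
below.

Perron's principle rests on Harnack's inequality. On a disk, choose a member `f` within `ε` of the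
supremum `u` at the center. For any other member `g` and `k = max(f, g)`, the Poisson integral of `k
- f` is non-negative and at most `ε` at the center, so Harnack bounds it throughout the disk
independently of `g`. Thus `u` is a locally uniform limit of Poisson integrals
(`isHarmonicallyApproximable_of_isLUB`), with one `f` for each `ε` and no countable dense set, so
second countability plays no role.

For Dirichlet's principle, `u` is the supremum of the subsolutions: functions with values in `[m,
M]`, continuous on `Y`, subharmonic inside, and at most `f` on the boundary. Smoothness of the
boundary gives an exterior disk in a holomorphic chart, and `log |z - a|`, with `a` its center,
gives a barrier (`exists_barrier`). The barrier bounds all subsolutions from above near a boundary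
point and also builds one that nearly attains `f` there, which forces continuity. All barrier
arguments take place in one compact chart disk, so `Y` need not be compact. -/

/-! ### The Poisson integral on the unit disk and its boundary values. -/

/-- The Poisson integral over the unit circle of the boundary values `v`. -/
def poissonIntegral (v : ℂ → ℝ) (z : ℂ) : ℝ :=
  circleAverage (fun ζ : ℂ => poissonKernel 0 z ζ * v ζ) 0 1

lemma continuousOn_poissonKernel_sphere {z : ℂ} (hz : z ∈ ball (0 : ℂ) 1) :
    ContinuousOn (poissonKernel 0 z) (sphere 0 1) := by
  have h := continuousOn_herglotzRieszKernel_sphere hz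
  rw [abs_one] at h
  rw [poissonKernel_eq_re_herglotzRieszKernel]
  exact Complex.continuous_re.comp_continuousOn h

lemma circleIntegrable_poissonKernel_mul {v : ℂ → ℝ} (hv : ContinuousOn v (sphere 0 1)) {z : ℂ}
    (hz : z ∈ ball (0 : ℂ) 1) :
    CircleIntegrable (fun ζ => poissonKernel 0 z ζ * v ζ) 0 1 :=
  ((continuousOn_poissonKernel_sphere hz).mul hv).circleIntegrable zero_le_one

lemma poissonKernel_nonneg {z ζ : ℂ} (hz : z ∈ ball (0 : ℂ) 1) (hζ : ζ ∈ sphere (0 : ℂ) 1) :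
    0 ≤ poissonKernel 0 z ζ := by
  rw [mem_ball_zero_iff] at hz
  rw [mem_sphere_zero_iff_norm] at hζ
  rw [poissonKernel_def, sub_zero, sub_zero, hζ]
  have := norm_nonneg z
  apply div_nonneg _ (sq_nonneg _)
  nlinarith

lemma poissonKernel_le {z ζ : ℂ} (hz : z ∈ ball (0 : ℂ) 1) (hζ : ζ ∈ sphere (0 : ℂ) 1) :
    poissonKernel 0 z ζ ≤ (1 + ‖z‖) / (1 - ‖z‖) := by
  have := re_herglotzRieszKernel_le hζ hz
  rw [poissonKernel_eq_re_herglotzRieszKernel]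
  simpa [herglotzRieszKernel_def] using this

lemma poissonIntegral_of_harmonicOnNhd {v : ℂ → ℝ} (hv : HarmonicOnNhd v (closedBall 0 1)) {z : ℂ}
    (hz : z ∈ ball (0 : ℂ) 1) : poissonIntegral v z = v z :=
  InnerProductSpace.HarmonicOnNhd.circleAverage_poissonKernel_smul hv hz

lemma poissonIntegral_const (c : ℝ) {z : ℂ} (hz : z ∈ ball (0 : ℂ) 1) :
    poissonIntegral (fun _ => c) z = c :=
  poissonIntegral_of_harmonicOnNhd (harmonicOnNhd_const c) hz

lemma poissonIntegral_mono {v w : ℂ → ℝ} (hv : ContinuousOn v (sphere 0 1))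
    (hw : ContinuousOn w (sphere 0 1)) (h : ∀ ζ ∈ sphere (0 : ℂ) 1, v ζ ≤ w ζ) {z : ℂ}
    (hz : z ∈ ball (0 : ℂ) 1) : poissonIntegral v z ≤ poissonIntegral w z := by
  apply circleAverage_mono (circleIntegrable_poissonKernel_mul hv hz)
    (circleIntegrable_poissonKernel_mul hw hz)
  intro ζ hζ
  rw [abs_one] at hζ
  exact mul_le_mul_of_nonneg_left (h ζ hζ) (poissonKernel_nonneg hz hζ)

lemma poissonIntegral_sub {v w : ℂ → ℝ} (hv : ContinuousOn v (sphere 0 1))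
    (hw : ContinuousOn w (sphere 0 1)) {z : ℂ} (hz : z ∈ ball (0 : ℂ) 1) :
    poissonIntegral (fun ζ => v ζ - w ζ) z = poissonIntegral v z - poissonIntegral w z := by
  simp only [poissonIntegral, mul_sub]
  exact circleAverage_fun_sub (circleIntegrable_poissonKernel_mul hv hz)
    (circleIntegrable_poissonKernel_mul hw hz)

lemma poissonIntegral_zero (v : ℂ → ℝ) : poissonIntegral v 0 = circleAverage v 0 1 := by
  apply circleAverage_congr_sphere
  intro ζ hζ
  rw [abs_one, mem_sphere_zero_iff_norm] at hζ
  simp [poissonKernel_def, hζ]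

/-- **Harnack's inequality** for Poisson integrals of nonnegative functions. -/
lemma poissonIntegral_le_harnack {v : ℂ → ℝ} (hv : ContinuousOn v (sphere 0 1))
    (h : ∀ ζ ∈ sphere (0 : ℂ) 1, 0 ≤ v ζ) {z : ℂ} (hz : z ∈ ball (0 : ℂ) 1) :
    poissonIntegral v z ≤ (1 + ‖z‖) / (1 - ‖z‖) * poissonIntegral v 0 := by
  have e : (1 + ‖z‖) / (1 - ‖z‖) * poissonIntegral v 0 =
      circleAverage (fun ζ => ((1 + ‖z‖) / (1 - ‖z‖)) • v ζ) 0 1 := by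
    rw [circleAverage_fun_smul, poissonIntegral_zero, smul_eq_mul]
  rw [e]
  apply circleAverage_mono (circleIntegrable_poissonKernel_mul hv hz)
    (ContinuousOn.circleIntegrable zero_le_one (hv.fun_const_smul _))
  intro ζ hζ
  rw [abs_one] at hζ
  exact mul_le_mul_of_nonneg_right (poissonKernel_le hz hζ) (h ζ hζ)

/-- The Poisson kernel is the real part of the Herglotz–Riesz kernel, whose integral against `v` is
analytic in `z`. -/
lemma harmonicAt_poissonIntegral {v : ℂ → ℝ} (hv : ContinuousOn v (sphere 0 1)) {z : ℂ}
    (hz : z ∈ ball (0 : ℂ) 1) : HarmonicAt (poissonIntegral v) z := by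
  have hi : CircleIntegrable v 0 1 := hv.circleIntegrable zero_le_one
  have hi' : CircleIntegrable (fun ζ => (v ζ : ℂ)) 0 1 :=
    (Complex.continuous_ofReal.comp_continuousOn hv).circleIntegrable zero_le_one
  have h := (analyticOnNhd_circleAverage_herglotzRieszKernel_smul hi' z hz).harmonicAt_re
  refine (harmonicAt_congr_nhds ?_).1 h
  filter_upwards [isOpen_ball.mem_nhds hz] with w hw
  have := re_circleAverage_herglotzRieszKernel_smul hi hw
  rw [← poissonKernel_eq_re_herglotzRieszKernel] at this
  exact this

lemma continuousOn_poissonIntegral {v : ℂ → ℝ} (hv : ContinuousOn v (sphere 0 1)) :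
    ContinuousOn (poissonIntegral v) (ball 0 1) := fun _ hz =>
  (harmonicAt_poissonIntegral hv hz).1.continuousAt.continuousWithinAt

/-- On the circle `2 - 2 Re(z * conj z₀)` equals `|z - z₀|²`, but it is harmonic in `z`, so it is
its own Poisson integral. A bound of `|v - v z₀|` by such a function on the circle therefore passes
to the disk by positivity of the kernel. -/
lemma abs_poissonIntegral_sub_le {v : ℂ → ℝ} (hv : ContinuousOn v (sphere 0 1)) {z₀ : ℂ}
    (hz₀ : z₀ ∈ sphere (0 : ℂ) 1) {ε : ℝ} (hε : 0 < ε) :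
    ∃ C : ℝ, ∀ z ∈ ball (0 : ℂ) 1,
      |poissonIntegral v z - v z₀| ≤ ε + C * (2 - 2 * (z * (starRingEnd ℂ) z₀).re) := by
  obtain ⟨B, hB⟩ := (isCompact_sphere (0 : ℂ) 1).exists_bound_of_continuousOn hv
  obtain ⟨δ, hδ, hvδ⟩ := Metric.continuousOn_iff.1 hv z₀ hz₀ ε hε
  have hB0 : 0 ≤ B := (norm_nonneg _).trans (hB z₀ hz₀)
  -- With this constant, `C * |ζ - z₀|²` is at least `2 * B`, a bound for the oscillation of `v`, as
  -- soon as `|ζ - z₀| ≥ δ`.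
  set C := 2 * B / δ ^ 2 with hC
  have hC0 : 0 ≤ C := by positivity
  let q : ℂ → ℝ := fun z => ε + C * (2 - 2 * (z * (starRingEnd ℂ) z₀).re)
  have hqh : HarmonicOnNhd q (closedBall 0 1) := by
    intro z _
    have : AnalyticAt ℂ (fun z : ℂ => (ε : ℂ) + C * (2 - 2 * (z * (starRingEnd ℂ) z₀))) z := by
      fun_prop
    convert this.harmonicAt_re using 2 with w
    simp [q]
  have hqc : ContinuousOn q (sphere 0 1) := by fun_prop
  have hle : ∀ ζ ∈ sphere (0 : ℂ) 1, |v ζ - v z₀| ≤ q ζ := by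
    intro ζ hζ
    have hn : 2 - 2 * (ζ * (starRingEnd ℂ) z₀).re = ‖ζ - z₀‖ ^ 2 := by
      rw [mem_sphere_zero_iff_norm] at hζ hz₀
      rw [← Complex.normSq_eq_norm_sq, Complex.normSq_sub, Complex.normSq_eq_norm_sq,
        Complex.normSq_eq_norm_sq, hζ, hz₀]
      ring
    simp only [q, hn]
    rcases lt_or_ge (dist ζ z₀) δ with h | h
    · have := hvδ ζ hζ h
      rw [Real.dist_eq] at this
      have : 0 ≤ C * ‖ζ - z₀‖ ^ 2 := by positivity
      linarith
    · rw [dist_eq_norm] at h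
      have h1 : |v ζ - v z₀| ≤ 2 * B := by
        have := abs_sub (v ζ) (v z₀)
        have h1 := hB ζ hζ
        have h2 := hB z₀ hz₀
        rw [Real.norm_eq_abs] at h1 h2
        linarith
      have h2 : 2 * B ≤ C * ‖ζ - z₀‖ ^ 2 := by
        rw [hC, div_mul_eq_mul_div, le_div_iff₀ (by positivity)]
        gcongr
      linarith
  refine ⟨C, fun z hz => ?_⟩
  have hd := poissonIntegral_sub hv (continuousOn_const (c := v z₀)) hz
  rw [poissonIntegral_const _ hz] at hd
  have hq := poissonIntegral_of_harmonicOnNhd hqh hz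
  have hvc : ContinuousOn (fun ζ => v ζ - v z₀) (sphere 0 1) := hv.sub continuousOn_const
  change _ ≤ q z
  rw [← hd, ← hq, abs_le]
  constructor
  · have h0 := poissonIntegral_sub (continuousOn_const (c := (0 : ℝ))) hqc hz
    rw [poissonIntegral_const _ hz, zero_sub] at h0
    rw [← h0]
    refine poissonIntegral_mono (continuousOn_const.sub hqc) hvc (fun ζ hζ => ?_) hz
    have := abs_le.1 (hle ζ hζ)
    simp only [Pi.sub_apply]
    linarith [this.1]
  · exact poissonIntegral_mono hvc hqc (fun ζ hζ => (le_abs_self _).trans (hle ζ hζ)) hz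

lemma tendsto_poissonIntegral {v : ℂ → ℝ} (hv : ContinuousOn v (sphere 0 1)) {z₀ : ℂ}
    (hz₀ : z₀ ∈ sphere (0 : ℂ) 1) :
    Tendsto (poissonIntegral v) (𝓝[ball 0 1] z₀) (𝓝 (v z₀)) := by
  rw [Metric.tendsto_nhds]
  intro ε hε
  obtain ⟨C, hC⟩ := abs_poissonIntegral_sub_le hv hz₀ (half_pos hε)
  have hcont : Continuous fun z : ℂ => ε / 2 + C * (2 - 2 * (z * (starRingEnd ℂ) z₀).re) := by
    fun_prop
  have hlim : ε / 2 + C * (2 - 2 * (z₀ * (starRingEnd ℂ) z₀).re) < ε := by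
    rw [mem_sphere_zero_iff_norm] at hz₀
    rw [Complex.mul_conj, Complex.normSq_eq_norm_sq, hz₀]
    norm_num
    exact hε
  filter_upwards [self_mem_nhdsWithin,
    nhdsWithin_le_nhds (hcont.continuousAt.eventually (gt_mem_nhds hlim))] with z hz hz2
  rw [Real.dist_eq]
  exact (hC z hz).trans_lt hz2

open Classical in
/-- The Poisson integral in the open unit disk together with its boundary values outside of it. -/
def poissonExtension (v : ℂ → ℝ) (z : ℂ) : ℝ :=
  if z ∈ ball (0 : ℂ) 1 then poissonIntegral v z else v z

lemma poissonExtension_of_mem (v : ℂ → ℝ) {z : ℂ} (hz : z ∈ ball (0 : ℂ) 1) :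
    poissonExtension v z = poissonIntegral v z := if_pos hz

lemma poissonExtension_of_notMem (v : ℂ → ℝ) {z : ℂ} (hz : z ∉ ball (0 : ℂ) 1) :
    poissonExtension v z = v z := if_neg hz

/-- Continuity is checked separately from inside and from outside the disk. The set `s` is arbitrary
so that it can be the whole target of a chart. -/
lemma continuousOn_poissonExtension {v : ℂ → ℝ} {s : Set ℂ} (hs : sphere 0 1 ⊆ s)
    (hv : ContinuousOn v s) : ContinuousOn (poissonExtension v) (s ∪ ball 0 1) := by
  have hv' := hv.mono hs
  intro z hz
  by_cases hzb : z ∈ ball (0 : ℂ) 1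
  · refine ContinuousAt.continuousWithinAt ?_
    refine ((continuousOn_poissonIntegral hv').continuousAt (isOpen_ball.mem_nhds hzb)).congr ?_
    filter_upwards [isOpen_ball.mem_nhds hzb] with w hw
    exact (poissonExtension_of_mem v hw).symm
  · have hzs : z ∈ s := hz.resolve_right hzb
    have hval := poissonExtension_of_notMem v hzb
    have h1 : ContinuousWithinAt (poissonExtension v) (s \ ball 0 1) z :=
      ((hv z hzs).mono sdiff_subset).congr
        (fun w hw => poissonExtension_of_notMem v hw.2) hval
    have h2 : ContinuousWithinAt (poissonExtension v) (ball 0 1) z := by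
      by_cases hsph : z ∈ sphere (0 : ℂ) 1
      · have := tendsto_poissonIntegral hv' hsph
        rw [ContinuousWithinAt, hval]
        refine this.congr' ?_
        filter_upwards [self_mem_nhdsWithin] with w hw
        exact (poissonExtension_of_mem v hw).symm
      · have : z ∉ closure (ball (0 : ℂ) 1) := by
          rw [closure_ball _ one_ne_zero, ← ball_union_sphere]
          exact fun h => h.elim hzb hsph
        exact continuousWithinAt_of_notMem_closure this
    refine (h1.union h2).mono ?_
    intro w hw
    by_cases hwb : w ∈ ball (0 : ℂ) 1
    · exact Or.inr hwb
    · exact Or.inl ⟨hw.resolve_right hwb, hwb⟩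

/-! ### The submean inequality and the maximum principle in the plane. -/

/-- `v` is at `z` at most its average over all small circles around `z`. -/
def IsSubmeanAt (v : ℂ → ℝ) (z : ℂ) : Prop :=
  ∀ᶠ r in 𝓝[>] (0 : ℝ), v z ≤ circleAverage v z r

lemma eventually_closedBall_subset {s : Set ℂ} {z : ℂ} (hs : s ∈ 𝓝 z) :
    ∀ᶠ r in 𝓝[>] (0 : ℝ), 0 < r ∧ closedBall z r ⊆ s := by
  obtain ⟨ε, hε, h⟩ := Metric.nhds_basis_closedBall.mem_iff.1 hs
  filter_upwards [Ioc_mem_nhdsGT hε] with r hr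
  exact ⟨hr.1, (closedBall_subset_closedBall hr.2).trans h⟩

lemma circleIntegrable_of_continuousOn_closedBall {v : ℂ → ℝ} {s : Set ℂ} {z : ℂ} {r : ℝ}
    (hr : 0 < r) (h : closedBall z r ⊆ s) (hv : ContinuousOn v s) : CircleIntegrable v z r :=
  (hv.mono (sphere_subset_closedBall.trans h)).circleIntegrable hr.le

/-- A function touched from below at `z` by a submean function inherits the inequality. This handles
both maxima and the boundary circle of a Poisson modification. -/
lemma IsSubmeanAt.mono {v w : ℂ → ℝ} {z : ℂ} {s : Set ℂ} (hs : s ∈ 𝓝 z) (hv : ContinuousOn v s)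
    (hw : ContinuousOn w s) (h : IsSubmeanAt v z) (hz : w z = v z) (hle : ∀ y ∈ s, v y ≤ w y) :
    IsSubmeanAt w z := by
  filter_upwards [h, eventually_closedBall_subset hs] with r hr ⟨h0, hsub⟩
  rw [hz]
  refine hr.trans (circleAverage_mono (circleIntegrable_of_continuousOn_closedBall h0 hsub hv)
    (circleIntegrable_of_continuousOn_closedBall h0 hsub hw) fun y hy => hle y (hsub ?_))
  rw [abs_of_pos h0] at hy
  exact sphere_subset_closedBall hy

lemma eventually_circleAverage_eq_of_harmonicAt {h : ℂ → ℝ} {z : ℂ} (hh : HarmonicAt h z) :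
    ∀ᶠ r in 𝓝[>] (0 : ℝ), circleAverage h z r = h z := by
  filter_upwards [eventually_closedBall_subset hh.eventually] with r ⟨h0, hsub⟩
  apply InnerProductSpace.HarmonicOnNhd.circleAverage_eq
  rw [abs_of_pos h0]
  exact fun y hy => hsub hy

lemma IsSubmeanAt.of_harmonicAt {h : ℂ → ℝ} {z : ℂ} (hh : HarmonicAt h z) : IsSubmeanAt h z :=
  (eventually_circleAverage_eq_of_harmonicAt hh).mono fun _ hr => hr.ge

lemma IsSubmeanAt.sub_harmonicAt {v h : ℂ → ℝ} {z : ℂ} {s : Set ℂ} (hs : s ∈ 𝓝 z)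
    (hv : ContinuousOn v s) (hsub : IsSubmeanAt v z) (hh : HarmonicAt h z) :
    IsSubmeanAt (fun y => v y - h y) z := by
  have hc : {y | HarmonicAt h y} ∈ 𝓝 z := hh.eventually
  have hcont : ContinuousOn h {y | HarmonicAt h y} := fun y hy =>
    hy.1.continuousAt.continuousWithinAt
  filter_upwards [hsub, eventually_circleAverage_eq_of_harmonicAt hh,
    eventually_closedBall_subset hs, eventually_closedBall_subset hc] with r h1 h2 ⟨h0, h3⟩ ⟨_, h4⟩
  rw [circleAverage_fun_sub (circleIntegrable_of_continuousOn_closedBall h0 h3 hv)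
    (circleIntegrable_of_continuousOn_closedBall h0 h4 hcont), h2]
  linarith

/-- By continuity, strict inequality at the single point `z + r` persists on an arc, which makes the
average strict. -/
lemma circleAverage_lt_of_le_of_exists_lt {v : ℂ → ℝ} {z : ℂ} {r m : ℝ}
    (hv : ContinuousOn v (sphere z |r|)) (hle : ∀ y ∈ sphere z |r|, v y ≤ m)
    (hlt : v (z + r) < m) : circleAverage v z r < m := by
  have hc : Continuous fun θ => v (circleMap z r θ) :=
    hv.comp_continuous (continuous_circleMap z r) fun θ => circleMap_mem_sphere' z r θ
  rw [← circleAverage_const m z r, circleAverage_def, circleAverage_def, smul_eq_mul, smul_eq_mul]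
  apply mul_lt_mul_of_pos_left _ (inv_pos.2 two_pi_pos)
  apply intervalIntegral.integral_lt_integral_of_continuousOn_of_le_of_exists_lt two_pi_pos
    hc.continuousOn continuousOn_const
  · exact fun θ _ => hle _ (circleMap_mem_sphere' z r θ)
  · exact ⟨0, ⟨le_rfl, two_pi_pos.le⟩, by simpa [circleMap] using hlt⟩

/-- **Maximum principle**. -/
lemma nonpos_of_isSubmeanAt {K : Set ℂ} (hK : IsCompact K) {v : ℂ → ℝ} (hv : ContinuousOn v K)
    (h : ∀ z ∈ K, v z ≤ 0 ∨ (K ∈ 𝓝 z ∧ IsSubmeanAt v z)) : ∀ z ∈ K, v z ≤ 0 := by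
  by_contra! hcon
  obtain ⟨z₁, hz₁, hpos⟩ := hcon
  obtain ⟨a, ha, hmax⟩ := hK.exists_isMaxOn ⟨z₁, hz₁⟩ hv
  have hapos : 0 < v a := hpos.trans_le (hmax hz₁)
  have hA : IsCompact (K ∩ v ⁻¹' {v a}) := by
    obtain ⟨t, ht, he⟩ := (continuousOn_iff_isClosed.1 hv) {v a} isClosed_singleton
    rw [inter_comm, he]
    exact hK.inter_left ht
  -- Among the maximum points, take one with largest real part. Then `b + r` is not a maximum point,
  -- and the average over the circle around `b` is strictly below `v b`.
  obtain ⟨b, ⟨hbK, hbv⟩, hbmax⟩ := hA.exists_isMaxOn ⟨a, ha, rfl⟩ Complex.continuous_re.continuousOn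
  have hbv : v b = v a := hbv
  rcases h b hbK with hb | ⟨hb, hsub⟩
  · linarith
  · obtain ⟨r, hr, h0, hball⟩ := (hsub.and (eventually_closedBall_subset hb)).exists
    have hs : sphere b |r| ⊆ K := by
      rw [abs_of_pos h0]
      exact sphere_subset_closedBall.trans hball
    have hmem : b + r ∈ sphere b |r| := by simp
    have hlt : v (b + r) < v b := by
      rw [hbv]
      refine lt_of_le_of_ne (hmax (hs hmem)) fun he => ?_
      have : (b + r).re ≤ b.re := hbmax ⟨hs hmem, he⟩
      simp at this
      linarith
    have := circleAverage_lt_of_le_of_exists_lt (hv.mono hs)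
      (fun y hy => (hmax (hs hy)).trans_eq hbv.symm) hlt
    linarith

/-- Maximum principle for `v` minus its Poisson extension: the difference vanishes on the circle and
is submean inside, since the extension is harmonic there. -/
lemma le_poissonIntegral_of_isSubmeanAt {v : ℂ → ℝ} (hv : ContinuousOn v (closedBall 0 1))
    (h : ∀ z ∈ ball (0 : ℂ) 1, IsSubmeanAt v z) {z : ℂ} (hz : z ∈ ball (0 : ℂ) 1) :
    v z ≤ poissonIntegral v z := by
  have hs : ContinuousOn v (sphere 0 1) := hv.mono sphere_subset_closedBall
  have hext : ContinuousOn (poissonExtension v) (closedBall 0 1) :=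
    (continuousOn_poissonExtension sphere_subset_closedBall hv).mono subset_union_left
  have key := nonpos_of_isSubmeanAt (isCompact_closedBall (0 : ℂ) 1) (hv.sub hext) (by
    intro y hy
    by_cases hyb : y ∈ ball (0 : ℂ) 1
    · have hn : closedBall (0 : ℂ) 1 ∈ 𝓝 y :=
        mem_of_superset (isOpen_ball.mem_nhds hyb) ball_subset_closedBall
      refine Or.inr ⟨hn, IsSubmeanAt.sub_harmonicAt hn hv (h y hyb) ?_⟩
      refine (harmonicAt_congr_nhds ?_).1 (harmonicAt_poissonIntegral hs hyb)
      filter_upwards [isOpen_ball.mem_nhds hyb] with w hw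
      exact (poissonExtension_of_mem v hw).symm
    · left
      simp [poissonExtension_of_notMem v hyb])
  have := key z (ball_subset_closedBall hz)
  simp only [Pi.sub_apply, poissonExtension_of_mem v hz] at this
  linarith

/-! ### Functions read in charts. -/

section OpenPartialHomeomorph

variable {X : Type*} [TopologicalSpace X]

lemma contDiffOn_transition {𝕜 : Type*} [NontriviallyNormedField 𝕜] [NormedSpace 𝕜 ℂ] {n : ℕ∞ω}
    {φ ψ : OpenPartialHomeomorph X ℂ} (h : φ.symm.trans ψ ∈ contDiffGroupoid n 𝓘(𝕜, ℂ)) :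
    ContDiffOn 𝕜 n (ψ ∘ φ.symm) (φ.target ∩ φ.symm ⁻¹' ψ.source) := by
  rw [contDiffGroupoid, mem_groupoid_of_pregroupoid] at h
  have := h.1
  simpa [contDiffPregroupoid] using this

lemma mem_nhds_chart {φ : OpenPartialHomeomorph X ℂ} {U : Set X} {x : X} (hx : x ∈ φ.source)
    (hU : U ∈ 𝓝 x) : φ.target ∩ φ.symm ⁻¹' U ∈ 𝓝 (φ x) := by
  apply inter_mem (φ.open_target.mem_nhds (φ.map_source hx))
  apply (φ.continuousAt_symm (φ.map_source hx)).preimage_mem_nhds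
  rwa [φ.left_inv hx]

lemma continuousOn_comp_symm {φ : OpenPartialHomeomorph X ℂ} {U : Set X} {u : X → ℝ}
    (hu : ContinuousOn u U) : ContinuousOn (u ∘ φ.symm) (φ.target ∩ φ.symm ⁻¹' U) :=
  hu.comp (φ.continuousOn_symm.mono inter_subset_left) fun _ hz => hz.2

lemma poissonModification_of_mem {φ : OpenPartialHomeomorph X ℂ} {u : X → ℝ} {x : X}
    (hx : x ∈ disk φ) : poissonModification φ u x = poissonIntegral (u ∘ φ.symm) (φ x) := if_pos hx

lemma poissonModification_of_notMem {φ : OpenPartialHomeomorph X ℂ} {u : X → ℝ} {x : X}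
    (hx : x ∉ disk φ) : poissonModification φ u x = u x := if_neg hx

lemma poissonModification_eq_poissonExtension {φ : OpenPartialHomeomorph X ℂ} {u : X → ℝ} {x : X}
    (hx : x ∈ φ.source) :
    poissonModification φ u x = poissonExtension (u ∘ φ.symm) (φ x) := by
  by_cases h : φ x ∈ ball (0 : ℂ) 1
  · rw [poissonModification_of_mem ⟨hx, h⟩, poissonExtension_of_mem _ h]
  · rw [poissonModification_of_notMem (fun hd => h hd.2), poissonExtension_of_notMem _ h]
    simp [φ.left_inv hx]

end OpenPartialHomeomorph

/-! ### Disk charts and the local character of subharmonicity. -/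

section Charts

variable {X : Type*} [TopologicalSpace X] [ChartedSpace ℂ X]

/-- The affine homeomorphism of the plane sending the disk of center `c` and radius `r` to the unit
disk. -/
def affineHomeomorph (c : ℂ) (r : ℝ) (hr : r ≠ 0) : ℂ ≃ₜ ℂ where
  toFun w := (r : ℂ)⁻¹ * (w - c)
  invFun w := r * w + c
  left_inv w := by
    have : (r : ℂ) ≠ 0 := by exact_mod_cast hr
    field_simp
    ring
  right_inv w := by
    have : (r : ℂ) ≠ 0 := by exact_mod_cast hr
    field_simp
    ring
  continuous_toFun := by fun_prop
  continuous_invFun := by fun_prop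

lemma affineHomeomorph_mem_contDiffGroupoid (c : ℂ) (r : ℝ) (hr : r ≠ 0) :
    (affineHomeomorph c r hr).toOpenPartialHomeomorph ∈ contDiffGroupoid 1 𝓘(ℂ) := by
  rw [contDiffGroupoid, mem_groupoid_of_pregroupoid]
  constructor
  · have : ContDiff ℂ 1 fun w : ℂ => (r : ℂ)⁻¹ * (w - c) := by fun_prop
    exact this.contDiffOn
  · have : ContDiff ℂ 1 fun w : ℂ => (r : ℂ) * w + c := by fun_prop
    exact this.contDiffOn

/-- Restricting `φ` to `U` and composing with an affine map stays in the maximal atlas, so every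
round disk in a chart counts as a disk of the surface. -/
lemma exists_isDiskChart {φ : OpenPartialHomeomorph X ℂ}
    (hφ : φ ∈ IsManifold.maximalAtlas 𝓘(ℂ) 1 X) {U : Set X} (hU : IsOpen U) {c : ℂ} {r : ℝ}
    (hr : 0 < r) (h : closedBall c r ⊆ φ.target ∩ φ.symm ⁻¹' U) :
    ∃ ψ : OpenPartialHomeomorph X ℂ, IsDiskChart ψ ∧ ψ.source ⊆ U ∧ ψ.source ⊆ φ.source ∧
      (∀ w, ψ.symm w = φ.symm (r * w + c)) ∧ ∀ x, ψ x = (r : ℂ)⁻¹ * (φ x - c) := by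
  have hA := affineHomeomorph_mem_contDiffGroupoid c r hr.ne'
  have hR : φ.restr U ∈ (contDiffGroupoid 1 𝓘(ℂ)).maximalAtlas X :=
    restr_mem_maximalAtlas _ hφ hU
  refine ⟨(φ.restr U).trans (affineHomeomorph c r hr.ne').toOpenPartialHomeomorph,
    ⟨?_, ?_⟩, ?_, ?_, ?_, ?_⟩
  · intro e he
    constructor
    · rw [OpenPartialHomeomorph.trans_symm_eq_symm_trans_symm, OpenPartialHomeomorph.trans_assoc]
      exact StructureGroupoid.trans _ (StructureGroupoid.symm _ hA) (hR e he).1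
    · rw [← OpenPartialHomeomorph.trans_assoc]
      exact StructureGroupoid.trans _ (hR e he).2 hA
  · intro w hw
    have : (r : ℂ) * w + c ∈ closedBall c r := by
      rw [mem_closedBall_zero_iff] at hw
      rw [mem_closedBall_iff_norm, add_sub_cancel_right, norm_mul, Complex.norm_real,
        Real.norm_of_nonneg hr.le]
      nlinarith
    have h2 := h this
    simp only [OpenPartialHomeomorph.trans_target, OpenPartialHomeomorph.restr_target, hU.interior_eq]
    exact ⟨mem_univ _, h2⟩
  · simp [hU.interior_eq]
  · simp [hU.interior_eq]
  · intro w; rfl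
  · intro w; rfl

lemma exists_isDiskChart_at [IsManifold 𝓘(ℂ) 1 X] {U : Set X} (hU : IsOpen U) {x : X}
    (hx : x ∈ U) : ∃ ψ : OpenPartialHomeomorph X ℂ, IsDiskChart ψ ∧ ψ.source ⊆ U ∧
      x ∈ ψ.source ∧ ψ x = 0 := by
  have hn := mem_nhds_chart (mem_chart_source ℂ x) (hU.mem_nhds hx)
  obtain ⟨r, h0, hr⟩ := (eventually_closedBall_subset hn).exists
  obtain ⟨ψ, h1, h2, -, h4, h5⟩ :=
    exists_isDiskChart (IsManifold.chart_mem_maximalAtlas x) hU h0 hr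
  have h0t : (0 : ℂ) ∈ ψ.target := h1.2 (mem_closedBall_self zero_le_one)
  have hx : ψ.symm 0 = x := by
    rw [h4]
    simp
  refine ⟨ψ, h1, h2, hx ▸ ψ.map_target h0t, by rw [h5]; simp⟩

/-- `u` is subharmonic at `x`: in every holomorphic chart, `u x` is at most the average of `u` over
all small circles around `x`. -/
def IsSubharmonicAt (u : X → ℝ) (x : X) : Prop :=
  ∀ φ ∈ IsManifold.maximalAtlas 𝓘(ℂ) 1 X, x ∈ φ.source → IsSubmeanAt (u ∘ φ.symm) (φ x)

lemma IsSubharmonicAt.mono {u v : X → ℝ} {x : X} {U : Set X} (hU : U ∈ 𝓝 x)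
    (hu : ContinuousOn u U) (hv : ContinuousOn v U) (h : IsSubharmonicAt u x) (hx : v x = u x)
    (hle : ∀ y ∈ U, u y ≤ v y) : IsSubharmonicAt v x := fun φ hφ hxφ =>
  (h φ hφ hxφ).mono (mem_nhds_chart hxφ hU) (continuousOn_comp_symm hu)
    (continuousOn_comp_symm hv) (by simp [φ.left_inv hxφ, hx]) fun _ hy => hle _ hy.2

/-- Near `f z`, `h` is the real part of an analytic function, which can be composed with `f`. -/
lemma harmonicAt_comp_analyticAt {h : ℂ → ℝ} {f : ℂ → ℂ} {z : ℂ} (hh : HarmonicAt h (f z))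
    (hf : AnalyticAt ℂ f z) : HarmonicAt (h ∘ f) z := by
  obtain ⟨r, hr, hball⟩ := Metric.mem_nhds_iff.1 hh.eventually
  obtain ⟨F, hF, hFe⟩ := HarmonicOnNhd.exists_analyticOnNhd_ball_re_eq (fun y hy => hball hy)
  have hmem := mem_ball_self (x := f z) hr
  refine (harmonicAt_congr_nhds ?_).1 ((hF _ hmem).comp hf).harmonicAt_re
  filter_upwards [hf.continuousAt.preimage_mem_nhds (isOpen_ball.mem_nhds hmem)] with w hw
  exact hFe hw

lemma analyticAt_transition {φ ψ : OpenPartialHomeomorph X ℂ}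
    (hφ : φ ∈ IsManifold.maximalAtlas 𝓘(ℂ) 1 X) (hψ : ψ ∈ IsManifold.maximalAtlas 𝓘(ℂ) 1 X)
    {x : X} (hxφ : x ∈ φ.source) (hxψ : x ∈ ψ.source) : AnalyticAt ℂ (ψ ∘ φ.symm) (φ x) :=
  ((contDiffOn_transition (StructureGroupoid.compatible_of_mem_maximalAtlas hφ hψ)).differentiableOn
    one_ne_zero).analyticAt (mem_nhds_chart hxφ (ψ.open_source.mem_nhds hxψ))

lemma IsSubharmonicAt.of_harmonicAt {u : X → ℝ} {x : X} {ψ : OpenPartialHomeomorph X ℂ}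
    (hψ : ψ ∈ IsManifold.maximalAtlas 𝓘(ℂ) 1 X) (hx : x ∈ ψ.source)
    (h : HarmonicAt (u ∘ ψ.symm) (ψ x)) : IsSubharmonicAt u x := by
  intro φ hφ hxφ
  apply IsSubmeanAt.of_harmonicAt
  have h' : HarmonicAt (u ∘ ψ.symm) ((ψ ∘ φ.symm) (φ x)) := by
    simpa [φ.left_inv hxφ] using h
  refine (harmonicAt_congr_nhds ?_).1
    (harmonicAt_comp_analyticAt h' (analyticAt_transition hφ hψ hxφ hx))
  filter_upwards [mem_nhds_chart hxφ (ψ.open_source.mem_nhds hx)] with z hz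
  simp [ψ.left_inv hz.2]

lemma IsSubharmonicOn.le_circleAverage {u : X → ℝ} {U : Set X} (hU : IsOpen U)
    (hu : IsSubharmonicOn u U) {φ : OpenPartialHomeomorph X ℂ}
    (hφ : φ ∈ IsManifold.maximalAtlas 𝓘(ℂ) 1 X) {c : ℂ} {r : ℝ} (hr : 0 < r)
    (h : closedBall c r ⊆ φ.target ∩ φ.symm ⁻¹' U) :
    (u ∘ φ.symm) c ≤ circleAverage (u ∘ φ.symm) c r := by
  obtain ⟨ψ, h1, h2, -, h4, -⟩ := exists_isDiskChart hφ hU hr h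
  have := hu.2 ψ h1 h2
  rw [circleAverage_eq_circleAverage_zero_one (f := u ∘ φ.symm)]
  have e : (u ∘ ψ.symm) = fun z => (u ∘ φ.symm) (r * z + c) := by
    ext z; simp [h4]
  rw [e, h4] at this
  simpa using this

lemma IsSubharmonicOn.isSubharmonicAt {u : X → ℝ} {U : Set X} (hU : IsOpen U)
    (hu : IsSubharmonicOn u U) {x : X} (hx : x ∈ U) : IsSubharmonicAt u x := by
  intro φ hφ hxφ
  filter_upwards [eventually_closedBall_subset (mem_nhds_chart hxφ (hU.mem_nhds hx))] with r ⟨h0, h⟩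
  exact hu.le_circleAverage hU hφ h0 h

/-- This is the passage from small circles to an entire disk. The bound holds at every point of the
disk, not only at its center, as Poisson modifications require. -/
lemma le_poissonIntegral_of_isSubharmonicAt {u : X → ℝ} {U : Set X} (hu : ContinuousOn u U)
    (h : ∀ x ∈ U, IsSubharmonicAt u x) {φ : OpenPartialHomeomorph X ℂ} (hφ : IsDiskChart φ)
    (hφU : φ.source ⊆ U) {z : ℂ} (hz : z ∈ ball (0 : ℂ) 1) :
    u (φ.symm z) ≤ poissonIntegral (u ∘ φ.symm) z := by
  have hsub : closedBall 0 1 ⊆ φ.target ∩ φ.symm ⁻¹' U := fun w hw =>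
    ⟨hφ.2 hw, hφU (φ.map_target (hφ.2 hw))⟩
  refine le_poissonIntegral_of_isSubmeanAt (v := u ∘ φ.symm)
    ((continuousOn_comp_symm hu).mono hsub) (fun w hw => ?_) hz
  have hw := hφ.2 (ball_subset_closedBall hw)
  have := h _ (hφU (φ.map_target hw)) φ hφ.1 (φ.map_target hw)
  rwa [φ.right_inv hw] at this

/-- Subharmonicity is a local property. -/
lemma isSubharmonicOn_iff {u : X → ℝ} {U : Set X} (hU : IsOpen U) :
    IsSubharmonicOn u U ↔ ContinuousOn u U ∧ ∀ x ∈ U, IsSubharmonicAt u x := by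
  refine ⟨fun h => ⟨h.1, fun x hx => h.isSubharmonicAt hU hx⟩, fun h => ⟨h.1, fun φ hφ hφU => ?_⟩⟩
  have := le_poissonIntegral_of_isSubharmonicAt h.1 h.2 hφ hφU (mem_ball_self one_pos)
  rw [poissonIntegral_zero] at this
  linarith

lemma continuousOn_max {Z : Type*} [TopologicalSpace Z] {u v : Z → ℝ} {U : Set Z}
    (hu : ContinuousOn u U) (hv : ContinuousOn v U) :
    ContinuousOn (fun x => max (u x) (v x)) U := hu.sup hv

lemma IsSubharmonicAt.max {u v : X → ℝ} {x : X} {U : Set X} (hU : U ∈ 𝓝 x)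
    (hu : ContinuousOn u U) (hv : ContinuousOn v U) (hu' : IsSubharmonicAt u x)
    (hv' : IsSubharmonicAt v x) : IsSubharmonicAt (fun x => max (u x) (v x)) x := by
  rcases le_total (v x) (u x) with h | h
  · exact hu'.mono hU hu (continuousOn_max hu hv) (max_eq_left h) fun y _ => le_max_left _ _
  · exact hv'.mono hU hv (continuousOn_max hu hv) (max_eq_right h) fun y _ => le_max_right _ _

lemma IsSubharmonicOn.max {u v : X → ℝ} {U : Set X} (hU : IsOpen U) (hu : IsSubharmonicOn u U)
    (hv : IsSubharmonicOn v U) : IsSubharmonicOn (fun x => max (u x) (v x)) U := by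
  rw [isSubharmonicOn_iff hU] at *
  exact ⟨continuousOn_max hu.1 hv.1, fun x hx => (hu.2 x hx).max (hU.mem_nhds hx) hu.1 hv.1 (hv.2 x hx)⟩

lemma isSubharmonicAt_const [IsManifold 𝓘(ℂ) 1 X] (c : ℝ) (x : X) :
    IsSubharmonicAt (fun _ : X => c) x :=
  IsSubharmonicAt.of_harmonicAt (IsManifold.chart_mem_maximalAtlas x) (mem_chart_source ℂ x)
    (harmonicAt_const c)

lemma isSubharmonicOn_const [IsManifold 𝓘(ℂ) 1 X] (c : ℝ) {U : Set X} (hU : IsOpen U) :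
    IsSubharmonicOn (fun _ : X => c) U :=
  (isSubharmonicOn_iff hU).2 ⟨continuousOn_const, fun x _ => isSubharmonicAt_const c x⟩

end Charts

/-! ### Poisson modifications of subharmonic functions. -/

section PoissonModification

variable {X : Type*} [TopologicalSpace X] [ChartedSpace ℂ X]

lemma IsDiskChart.symm_mem_disk {φ : OpenPartialHomeomorph X ℂ} (hφ : IsDiskChart φ) {z : ℂ}
    (hz : z ∈ ball (0 : ℂ) 1) : φ.symm z ∈ disk φ := by
  have ht := hφ.2 (ball_subset_closedBall hz)
  exact ⟨φ.map_target ht, by rwa [mem_preimage, φ.right_inv ht]⟩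

lemma IsDiskChart.poissonModification_symm {φ : OpenPartialHomeomorph X ℂ} (hφ : IsDiskChart φ)
    (u : X → ℝ) {z : ℂ} (hz : z ∈ ball (0 : ℂ) 1) :
    poissonModification φ u (φ.symm z) = poissonIntegral (u ∘ φ.symm) z := by
  rw [poissonModification_of_mem (hφ.symm_mem_disk hz),
    φ.right_inv (hφ.2 (ball_subset_closedBall hz))]

lemma IsDiskChart.continuousOn_sphere {φ : OpenPartialHomeomorph X ℂ} (hφ : IsDiskChart φ)
    {u : X → ℝ} {S : Set X} (hS : φ.source ⊆ S) (hu : ContinuousOn u S) :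
    ContinuousOn (u ∘ φ.symm) (sphere 0 1) :=
  (continuousOn_comp_symm hu).mono fun _ hw =>
    have hw := hφ.2 (sphere_subset_closedBall hw)
    ⟨hw, hS (φ.map_target hw)⟩

lemma IsDiskChart.isClosed_image_closedBall [T2Space X] {φ : OpenPartialHomeomorph X ℂ}
    (hφ : IsDiskChart φ) : IsClosed (φ.symm '' closedBall 0 1) :=
  ((isCompact_closedBall _ _).image_of_continuousOn (φ.continuousOn_symm.mono hφ.2)).isClosed

lemma continuousOn_poissonModification [T2Space X] {φ : OpenPartialHomeomorph X ℂ}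
    (hφ : IsDiskChart φ) {u : X → ℝ} {S : Set X} (hS : φ.source ⊆ S) (hu : ContinuousOn u S) :
    ContinuousOn (poissonModification φ u) S := by
  intro x hx
  by_cases hxφ : x ∈ φ.source
  · apply ContinuousAt.continuousWithinAt
    have hcomp : ContinuousOn (u ∘ φ.symm) φ.target :=
      (continuousOn_comp_symm hu).mono fun w hw => ⟨hw, hS (φ.map_target hw)⟩
    have h := (continuousOn_poissonExtension (sphere_subset_closedBall.trans hφ.2) hcomp).mono
      subset_union_left
    refine ((h.comp φ.continuousOn φ.mapsTo).continuousAt (φ.open_source.mem_nhds hxφ)).congr ?_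
    filter_upwards [φ.open_source.mem_nhds hxφ] with y hy
    exact (poissonModification_eq_poissonExtension hy).symm
  -- The Hausdorff property enters here: the compact closed disk is closed in `X`, so the
  -- modification agrees with `u` near every point outside the chart.
  · have hx' : x ∈ (φ.symm '' closedBall 0 1)ᶜ := by
      rintro ⟨w, hw, rfl⟩
      exact hxφ (φ.map_target (hφ.2 hw))
    have hev : ∀ y ∈ (φ.symm '' closedBall 0 1)ᶜ, poissonModification φ u y = u y := by
      intro y hy
      apply poissonModification_of_notMem
      exact fun hd => hy ⟨φ y, ball_subset_closedBall hd.2, φ.left_inv hd.1⟩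
    refine (hu x hx).congr_of_eventuallyEq ?_ (hev x hx')
    exact mem_nhdsWithin_of_mem_nhds
      (mem_of_superset (hφ.isClosed_image_closedBall.isOpen_compl.mem_nhds hx') hev)

lemma le_poissonModification {u : X → ℝ} {U : Set X} (hU : IsOpen U) (hu : IsSubharmonicOn u U)
    {φ : OpenPartialHomeomorph X ℂ} (hφ : IsDiskChart φ) (hφU : φ.source ⊆ U) (x : X) :
    u x ≤ poissonModification φ u x := by
  by_cases hx : x ∈ disk φ
  · rw [isSubharmonicOn_iff hU] at hu
    rw [poissonModification_of_mem hx]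
    have := le_poissonIntegral_of_isSubharmonicAt hu.1 hu.2 hφ hφU hx.2
    rwa [φ.left_inv hx.1] at this
  · rw [poissonModification_of_notMem hx]

/-- Inside the disk the modification is harmonic. Elsewhere, the bounding circle included, it equals
`u` at the point and dominates `u` around it. -/
lemma isSubharmonicOn_poissonModification [T2Space X] {u : X → ℝ} {U : Set X} (hU : IsOpen U)
    (hu : IsSubharmonicOn u U) {φ : OpenPartialHomeomorph X ℂ} (hφ : IsDiskChart φ)
    (hφU : φ.source ⊆ U) : IsSubharmonicOn (poissonModification φ u) U := by
  have hc := continuousOn_poissonModification hφ hφU hu.1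
  refine (isSubharmonicOn_iff hU).2 ⟨hc, fun x hx => ?_⟩
  by_cases hxd : x ∈ disk φ
  · refine IsSubharmonicAt.of_harmonicAt hφ.1 hxd.1 ((harmonicAt_congr_nhds ?_).1
      (harmonicAt_poissonIntegral (hφ.continuousOn_sphere hφU hu.1) hxd.2))
    filter_upwards [isOpen_ball.mem_nhds hxd.2] with z hz
    exact (hφ.poissonModification_symm u hz).symm
  · exact (hu.isSubharmonicAt hU hx).mono (hU.mem_nhds hx) hu.1 hc
      (poissonModification_of_notMem hxd) fun y _ => le_poissonModification hU hu hφ hφU y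

lemma poissonModification_mem_Icc {u : X → ℝ} {S : Set X} {φ : OpenPartialHomeomorph X ℂ}
    (hφ : IsDiskChart φ) (hS : φ.source ⊆ S) (hu : ContinuousOn u S) {m M : ℝ}
    (h : ∀ x ∈ S, u x ∈ Icc m M) {x : X} (hx : x ∈ S) :
    poissonModification φ u x ∈ Icc m M := by
  by_cases hxd : x ∈ disk φ
  · have hc := hφ.continuousOn_sphere hS hu
    have hb : ∀ ζ ∈ sphere (0 : ℂ) 1, (u ∘ φ.symm) ζ ∈ Icc m M := fun ζ hζ =>
      h _ (hS (φ.map_target (hφ.2 (sphere_subset_closedBall hζ))))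
    rw [poissonModification_of_mem hxd]
    constructor
    · rw [← poissonIntegral_const m hxd.2]
      exact poissonIntegral_mono continuousOn_const hc (fun ζ hζ => (hb ζ hζ).1) hxd.2
    · rw [← poissonIntegral_const M hxd.2]
      exact poissonIntegral_mono hc continuousOn_const (fun ζ hζ => (hb ζ hζ).2) hxd.2
  · rw [poissonModification_of_notMem hxd]
    exact h x hx

end PoissonModification

/-! ### Perron's principle via Harnack's inequality. -/

section Perron

lemma harnack_factor_le {z : ℂ} {ρ : ℝ} (hρ : ρ < 1) (hz : ‖z‖ ≤ ρ) :
    (1 + ‖z‖) / (1 - ‖z‖) ≤ 2 / (1 - ρ) := by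
  have := norm_nonneg z
  apply div_le_div₀ <;> linarith

/-- A function on the unit disk which is approximated by harmonic functions, uniformly on smaller
disks. -/
def IsHarmonicallyApproximable (v : ℂ → ℝ) : Prop :=
  ∀ ε > 0, ∃ H : ℂ → ℝ, HarmonicOnNhd H (ball 0 1) ∧
    ∀ z ∈ ball (0 : ℂ) 1, H z ≤ v z ∧ v z ≤ H z + (1 + ‖z‖) / (1 - ‖z‖) * ε

lemma IsHarmonicallyApproximable.continuousAt {v : ℂ → ℝ} (h : IsHarmonicallyApproximable v)
    {z : ℂ} (hz : z ∈ ball (0 : ℂ) 1) : ContinuousAt v z := by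
  apply continuousAt_of_locally_uniform_approx_of_continuousAt
  intro s hs
  obtain ⟨η, hη, hs⟩ := Metric.mem_uniformity_dist.1 hs
  obtain ⟨ρ, hzρ, hρ⟩ := exists_between (mem_ball_zero_iff.1 hz)
  have hρ' : 0 < 1 - ρ := by linarith
  -- On the disk of radius `ρ` the Harnack factor is at most `2 / (1 - ρ)`, so this tolerance yields
  -- an error of at most `η / 2`.
  obtain ⟨H, hH, hb⟩ := h (η * (1 - ρ) / 4) (by positivity)
  refine ⟨ball 0 ρ, isOpen_ball.mem_nhds (mem_ball_zero_iff.2 hzρ), H,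
    (hH z hz).1.continuousAt, fun y hy => hs ?_⟩
  rw [mem_ball_zero_iff] at hy
  obtain ⟨h1, h2⟩ := hb y (mem_ball_zero_iff.2 (hy.trans hρ))
  have h3 : (1 + ‖y‖) / (1 - ‖y‖) * (η * (1 - ρ) / 4) ≤ 2 / (1 - ρ) * (η * (1 - ρ) / 4) :=
    mul_le_mul_of_nonneg_right (harnack_factor_le hρ hy.le) (by positivity)
  have h4 : 2 / (1 - ρ) * (η * (1 - ρ) / 4) = η / 2 := by
    field_simp
    ring
  rw [Real.dist_eq, abs_of_nonneg (by linarith)]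
  linarith

/-- The mean value property survives uniform limits. The radius stays below 1 because the
approximation degenerates at the unit circle. -/
lemma IsHarmonicallyApproximable.circleAverage_eq {v : ℂ → ℝ} (h : IsHarmonicallyApproximable v)
    {ρ : ℝ} (h0 : 0 < ρ) (h1 : ρ < 1) : circleAverage v 0 ρ = v 0 := by
  have hsub : closedBall (0 : ℂ) ρ ⊆ ball 0 1 := closedBall_subset_ball h1
  have hv : ContinuousOn v (ball 0 1) := fun z hz => (h.continuousAt hz).continuousWithinAt
  have hvi := circleIntegrable_of_continuousOn_closedBall h0 hsub hv
  have hρ' : 0 < 1 - ρ := by linarith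
  have key : ∀ η > 0, |circleAverage v 0 ρ - v 0| ≤ η := by
    intro η hη
    obtain ⟨H, hH, hb⟩ := h (η * (1 - ρ) / 2) (by positivity)
    have hHc : ContinuousOn H (ball 0 1) := hH.continuousOn
    have hHi := circleIntegrable_of_continuousOn_closedBall h0 hsub hHc
    have hHm : circleAverage H 0 ρ = H 0 := by
      apply InnerProductSpace.HarmonicOnNhd.circleAverage_eq
      rw [abs_of_pos h0]
      exact hH.mono hsub
    have hbd : ∀ z ∈ closedBall (0 : ℂ) ρ, H z ≤ v z ∧ v z ≤ H z + η := by
      intro z hz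
      obtain ⟨a, b⟩ := hb z (hsub hz)
      have h3 : (1 + ‖z‖) / (1 - ‖z‖) * (η * (1 - ρ) / 2) ≤ 2 / (1 - ρ) * (η * (1 - ρ) / 2) :=
        mul_le_mul_of_nonneg_right (harnack_factor_le h1 (mem_closedBall_zero_iff.1 hz))
          (by positivity)
      have h4 : 2 / (1 - ρ) * (η * (1 - ρ) / 2) = η := by
        field_simp
      exact ⟨a, by linarith⟩
    have hs : ∀ z ∈ sphere (0 : ℂ) |ρ|, H z ≤ v z ∧ v z ≤ H z + η := fun z hz =>
      hbd z (sphere_subset_closedBall (by rwa [abs_of_pos h0] at hz))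
    have l1 := circleAverage_mono hHi hvi fun z hz => (hs z hz).1
    have hci : CircleIntegrable (fun _ => η) (0 : ℂ) ρ := continuousOn_const.circleIntegrable h0.le
    have l2 := circleAverage_mono (f₂ := fun z => H z + η) hvi
      (circleIntegrable_of_continuousOn_closedBall h0 hsub (hHc.add continuousOn_const))
      fun z hz => (hs z hz).2
    rw [circleAverage_fun_add hHi hci, circleAverage_const, hHm] at l2
    obtain ⟨c1, c2⟩ := hbd 0 (mem_closedBall_self h0.le)
    rw [abs_le]
    constructor <;> linarith
  have := le_of_forall_pos_le_add (a := |circleAverage v 0 ρ - v 0|) (b := 0)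
    fun η hη => by simpa using key η hη
  exact sub_eq_zero.1 (abs_nonpos_iff.1 this)

variable {X : Type*} [TopologicalSpace X] [ChartedSpace ℂ X]

lemma isHarmonicallyApproximable_of_isLUB {U : Set X} (hU : IsOpen U) {F : Set (X → ℝ)}
    (hsub : ∀ f ∈ F, IsSubharmonicOn f U)
    (hmax : ∀ f ∈ F, ∀ g ∈ F, (fun x => max (f x) (g x)) ∈ F)
    {φ : OpenPartialHomeomorph X ℂ} (hφ : IsDiskChart φ) (hφU : φ.source ⊆ U)
    (hpoisson : ∀ f ∈ F, poissonModification φ f ∈ F) {u : X → ℝ}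
    (hu : ∀ x ∈ U, IsLUB ((fun f : X → ℝ => f x) '' F) (u x)) :
    IsHarmonicallyApproximable (u ∘ φ.symm) := by
  intro ε hε
  have hmem : ∀ z ∈ closedBall (0 : ℂ) 1, φ.symm z ∈ U := fun z hz => hφU (φ.map_target (hφ.2 hz))
  have hle : ∀ f ∈ F, ∀ z ∈ ball (0 : ℂ) 1, poissonIntegral (f ∘ φ.symm) z ≤ u (φ.symm z) := by
    intro f hf z hz
    rw [← hφ.poissonModification_symm f hz]
    exact (hu _ (hmem z (ball_subset_closedBall hz))).1 ⟨_, hpoisson f hf, rfl⟩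
  have hle' : ∀ f ∈ F, ∀ z ∈ ball (0 : ℂ) 1, f (φ.symm z) ≤ poissonIntegral (f ∘ φ.symm) z := by
    intro f hf z hz
    have := (isSubharmonicOn_iff hU).1 (hsub f hf)
    exact le_poissonIntegral_of_isSubharmonicAt this.1 this.2 hφ hφU hz
  have h0 := mem_ball_self (x := (0 : ℂ)) one_pos
  -- This `f`, chosen only by its value at the center, serves every point `z` and every competitor
  -- `g`.
  obtain ⟨_, ⟨f, hf, rfl⟩, hfε, -⟩ :=
    (hu _ (hmem 0 (ball_subset_closedBall h0))).exists_between (sub_lt_self _ hε)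
  have hc : ∀ f ∈ F, ContinuousOn (f ∘ φ.symm) (sphere 0 1) := fun f hf =>
    hφ.continuousOn_sphere hφU (hsub f hf).1
  refine ⟨poissonIntegral (f ∘ φ.symm), fun z hz => harmonicAt_poissonIntegral (hc f hf) hz,
    fun z hz => ⟨hle f hf z hz, (hu _ (hmem z (ball_subset_closedBall hz))).2 ?_⟩⟩
  rintro _ ⟨g, hg, rfl⟩
  have hk := hmax f hf g hg
  set k : X → ℝ := fun x => max (f x) (g x) with hkdef
  have hharnack := poissonIntegral_le_harnack ((hc k hk).sub (hc f hf))
    (fun ζ _ => sub_nonneg.2 (le_max_left (f (φ.symm ζ)) (g (φ.symm ζ)))) hz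
  have e1 := poissonIntegral_sub (hc k hk) (hc f hf) hz
  have e2 := poissonIntegral_sub (hc k hk) (hc f hf) h0
  change poissonIntegral (fun ζ => (k ∘ φ.symm) ζ - (f ∘ φ.symm) ζ) z ≤
    _ * poissonIntegral (fun ζ => (k ∘ φ.symm) ζ - (f ∘ φ.symm) ζ) 0 at hharnack
  rw [e1, e2] at hharnack
  have hz1 : ‖z‖ < 1 := mem_ball_zero_iff.1 hz
  have hK : 0 ≤ (1 + ‖z‖) / (1 - ‖z‖) :=
    div_nonneg (by positivity) (by linarith)
  -- The Poisson modification of `k` is again in `F`, so its central value is at most `u`; that of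
  -- `f` is at least the value of `f`, hence above `u - ε`.
  have h1 : poissonIntegral (k ∘ φ.symm) 0 - poissonIntegral (f ∘ φ.symm) 0 ≤ ε := by
    have := hle k hk 0 h0
    have := hle' f hf 0 h0
    simp only at hfε
    linarith
  have h2 := mul_le_mul_of_nonneg_left h1 hK
  have h3 := hle' k hk z hz
  have h4 : g (φ.symm z) ≤ k (φ.symm z) := le_max_right _ _
  simp only
  linarith

/-- **Perron's principle** on an open subset of a Riemann surface. -/
theorem isHarmonicOn_of_isLUB [IsManifold 𝓘(ℂ) 1 X] {U : Set X} (hU : IsOpen U)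
    {F : Set (X → ℝ)} (hsub : ∀ f ∈ F, IsSubharmonicOn f U)
    (hmax : ∀ f ∈ F, ∀ g ∈ F, (fun x => max (f x) (g x)) ∈ F)
    (hpoisson : ∀ f ∈ F, ∀ φ : OpenPartialHomeomorph X ℂ, IsDiskChart φ → φ.source ⊆ U →
      poissonModification φ f ∈ F) {u : X → ℝ}
    (hu : ∀ x ∈ U, IsLUB ((fun f : X → ℝ => f x) '' F) (u x)) : IsHarmonicOn u U := by
  have key : ∀ φ : OpenPartialHomeomorph X ℂ, IsDiskChart φ → φ.source ⊆ U →
      IsHarmonicallyApproximable (u ∘ φ.symm) := fun φ hφ hφU =>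
    isHarmonicallyApproximable_of_isLUB hU hsub hmax hφ hφU
      (fun f hf => hpoisson f hf φ hφ hφU) hu
  constructor
  · intro x hx
    obtain ⟨φ, hφ, hφU, hxφ, h0⟩ := exists_isDiskChart_at hU hx
    have h1 : ContinuousAt (u ∘ φ.symm) (φ x) := by
      rw [h0]
      exact (key φ hφ hφU).continuousAt (mem_ball_self one_pos)
    refine ((h1.comp (φ.continuousAt hxφ)).congr ?_).continuousWithinAt
    filter_upwards [φ.open_source.mem_nhds hxφ] with y hy
    simp [φ.left_inv hy]
  · intro φ hφ hφU
    -- A slightly larger disk still fits in the chart. Rescaled by `ψ`, the unit circle of `φ`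
    -- becomes the circle of radius `1 / (δ + 1)`, strictly inside, where the approximation is
    -- uniform.
    obtain ⟨δ, hδ, hsub⟩ :=
      (isCompact_closedBall (0 : ℂ) 1).exists_cthickening_subset_open φ.open_target hφ.2
    rw [cthickening_closedBall hδ.le zero_le_one] at hsub
    have hR : 0 < δ + 1 := by linarith
    obtain ⟨ψ, h1, h2, -, h4, -⟩ := exists_isDiskChart hφ.1 hU hR
      (fun w hw => ⟨hsub hw, hφU (φ.map_target (hsub hw))⟩)
    have := (key ψ h1 h2).circleAverage_eq (inv_pos.2 hR) (inv_lt_one_of_one_lt₀ (by linarith))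
    rw [circleAverage_eq_circleAverage_zero_one] at this
    have e : (fun z : ℂ => (u ∘ ψ.symm) (((δ + 1)⁻¹ : ℝ) * z + 0)) = u ∘ φ.symm := by
      ext z
      have : ((δ + 1 : ℝ) : ℂ) ≠ 0 := by exact_mod_cast hR.ne'
      simp only [Function.comp_apply, h4, add_zero, Complex.ofReal_inv, mul_inv_cancel_left₀ this]
    rw [e] at this
    rw [this]
    simp [h4]

/-- **Perron's principle**. -/
theorem perron_principle [IsManifold 𝓘(ℂ) 1 X] {F : Set (X → ℝ)} (hne : F.Nonempty)
    (hF : IsPerronFamily F) (hb : IsLocallyBoundedAbove F) :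
    ∃ u : X → ℝ, (∀ x : X, IsLUB ((fun f : X → ℝ => f x) '' F) (u x)) ∧ IsHarmonic u := by
  have hlub : ∀ x : X, IsLUB ((fun f : X → ℝ => f x) '' F)
      (sSup ((fun f : X → ℝ => f x) '' F)) := by
    intro x
    obtain ⟨V, hV, C, hC⟩ := hb x
    refine isLUB_csSup (hne.image _) ⟨C, ?_⟩
    rintro _ ⟨f, hf, rfl⟩
    exact hC f hf x (mem_of_mem_nhds hV)
  exact ⟨fun x => sSup ((fun f : X → ℝ => f x) '' F), hlub,
    isHarmonicOn_of_isLUB isOpen_univ hF.subharmonic hF.max_mem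
      (fun f hf φ hφ _ => hF.poisson_mem f hf φ hφ) fun x _ => hlub x⟩

end Perron

/-! ### The exterior disk condition in the plane. -/

section Barrier

/-- The derivative of `ρ` is Lipschitz near `z₀`; the mean value inequality on the ball of radius
`‖z - z₀‖` then gives the quadratic remainder. -/
lemma exists_taylor_bound {ρ : ℂ → ℝ} {z₀ : ℂ} (h : ContDiffAt ℝ 2 ρ z₀) :
    ∃ C : ℝ, 0 ≤ C ∧ ∃ R > 0, ∀ z ∈ ball z₀ R,
      |ρ z - ρ z₀ - fderiv ℝ ρ z₀ (z - z₀)| ≤ C * ‖z - z₀‖ ^ 2 := by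
  have h1 : ContDiffAt ℝ 1 (fderiv ℝ ρ) z₀ := h.fderiv_right (by norm_num)
  obtain ⟨K, t, ht, hK⟩ := h1.exists_lipschitzOnWith
  have hd : ∀ᶠ z in 𝓝 z₀, DifferentiableAt ℝ ρ z :=
    (h.eventually (by simp)).mono fun z hz => hz.differentiableAt (by simp)
  obtain ⟨R, hR, hball⟩ := Metric.mem_nhds_iff.1 (inter_mem ht hd)
  refine ⟨K, K.2, R, hR, fun z hz => ?_⟩
  have hsub : closedBall z₀ ‖z - z₀‖ ⊆ ball z₀ R :=
    closedBall_subset_ball (mem_ball_iff_norm.1 hz)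
  have := (convex_closedBall z₀ ‖z - z₀‖).norm_image_sub_le_of_norm_hasFDerivWithin_le'
    (f := ρ) (f' := fderiv ℝ ρ) (φ := fderiv ℝ ρ z₀) (C := K * ‖z - z₀‖) (x := z₀) (y := z)
    (fun w hw => ((hball (hsub hw)).2 : DifferentiableAt ℝ ρ w).hasFDerivAt.hasFDerivWithinAt)
    (fun w hw => by
      have h2 := hK.dist_le_mul w (hball (hsub hw)).1 z₀ (mem_of_mem_nhds ht)
      rw [dist_eq_norm, dist_eq_norm] at h2
      exact h2.trans (mul_le_mul_of_nonneg_left (mem_closedBall_iff_norm.1 hw) K.2))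
    (mem_closedBall_self (norm_nonneg _)) (mem_closedBall_iff_norm.2 le_rfl)
  rw [Real.norm_eq_abs] at this
  calc _ ≤ _ := this
    _ = _ := by ring

/-- Where its gradient does not vanish, the set `0 ≤ ρ` satisfies an exterior disk condition. -/
lemma exists_exterior_disk {ρ : ℂ → ℝ} {z₀ : ℂ} (h : ContDiffAt ℝ 2 ρ z₀) (h0 : ρ z₀ = 0)
    (hd : fderiv ℝ ρ z₀ ≠ 0) :
    ∃ a : ℂ, a ≠ z₀ ∧ ∃ R > 0, ∀ z ∈ ball z₀ R, 0 ≤ ρ z → z ≠ z₀ → ‖z₀ - a‖ < ‖z - a‖ := by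
  obtain ⟨C, hC, R, hR, hT⟩ := exists_taylor_bound h
  set n : ℂ := (toDual ℝ ℂ).symm (fderiv ℝ ρ z₀) with hn
  have hn0 : n ≠ 0 := by simpa [hn] using hd
  have hL : ∀ w, fderiv ℝ ρ z₀ w = inner ℝ n w := fun w => by
    rw [hn, toDual_symm_apply]
  -- The center is `a = z₀ - s • n`, with `n` the gradient. Where `0 ≤ ρ`, the Taylor bound gives
  -- `|z - a|² - |z₀ - a|² ≥ (1 - 2 * s * C) * |z - z₀|²`, so `s` is taken small enough for a
  -- positive factor.
  set s : ℝ := (4 * (C + 1))⁻¹ with hs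
  have hs0 : 0 < s := by positivity
  have hsC : 2 * s * C < 1 := by
    rw [hs, mul_comm 2, mul_assoc, inv_mul_lt_iff₀ (by positivity)]
    linarith
  refine ⟨z₀ - s • n, ?_, R, hR, fun z hz hρ hne => ?_⟩
  · simp [hs0.ne', hn0]
  · have hT := (abs_le.1 (hT z hz)).2
    rw [h0, hL] at hT
    have hz0 : 0 < ‖z - z₀‖ ^ 2 := by
      have : 0 < ‖z - z₀‖ := norm_pos_iff.2 (sub_ne_zero.2 hne)
      positivity
    have e1 : z₀ - (z₀ - s • n) = s • n := by abel
    have e2 : z - (z₀ - s • n) = (z - z₀) + s • n := by abel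
    rw [e1, e2]
    refine lt_of_pow_lt_pow_left₀ 2 (norm_nonneg _) ?_
    rw [norm_add_sq_real, inner_smul_right, real_inner_comm]
    have : s * (-(C * ‖z - z₀‖ ^ 2)) ≤ s * inner ℝ n (z - z₀) :=
      mul_le_mul_of_nonneg_left (by linarith) hs0.le
    nlinarith

end Barrier

/-! ### Defining functions in other charts. -/

section Transition

variable {X : Type*} [TopologicalSpace X]

/-- The imaginary part of a smooth chart, read in another one, has nowhere vanishing derivative. -/
lemma fderiv_im_transition_ne_zero {φ ψ : OpenPartialHomeomorph X ℂ} {p : X}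
    (hφ : p ∈ φ.source) (hψ : p ∈ ψ.source)
    (h1 : DifferentiableAt ℝ (ψ ∘ φ.symm) (φ p)) (h2 : DifferentiableAt ℝ (φ ∘ ψ.symm) (ψ p)) :
    fderiv ℝ (fun z => (ψ (φ.symm z)).im) (φ p) ≠ 0 := by
  intro h
  have hρ : DifferentiableAt ℝ (fun z => (ψ (φ.symm z)).im) (φ p) :=
    Complex.imCLM.differentiableAt.comp (φ p) h1
  have hd : HasFDerivAt (fun z => (ψ (φ.symm z)).im) (0 : ℂ →L[ℝ] ℝ) ((φ ∘ ψ.symm) (ψ p)) := by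
    have := hρ.hasFDerivAt
    rw [h] at this
    simpa [ψ.left_inv hψ] using this
  have hcomp := hd.comp (ψ p) h2.hasFDerivAt
  -- The two transitions cancel near `ψ p`, so a zero derivative would make the derivative of `Im`
  -- vanish, although it sends `I` to 1.
  have heq : ((fun z => (ψ (φ.symm z)).im) ∘ (φ ∘ ψ.symm)) =ᶠ[𝓝 (ψ p)] Complex.imCLM := by
    filter_upwards [mem_nhds_chart hψ (φ.open_source.mem_nhds hφ)] with z hz
    simp [φ.left_inv hz.2, ψ.right_inv hz.1]
  have := hcomp.unique (Complex.imCLM.hasFDerivAt.congr_of_eventuallyEq heq)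
  have := congrArg (fun L : ℂ →L[ℝ] ℝ => L Complex.I) this
  simp at this

end Transition

/-! ### Boundary points of sub-manifolds and their barriers. -/

section Submanifold

variable {X : Type*} [TopologicalSpace X] [ChartedSpace ℂ X]

lemma IsSubmanifoldWithBoundary.mem_boundary_or_mem_interior {Y : Set X}
    (hY : IsSubmanifoldWithBoundary Y) {x : X} (hx : x ∈ Y) : x ∈ boundary Y ∨ x ∈ interior Y := by
  obtain ⟨ψ, hψ, hxψ, h⟩ := hY x hx
  rcases ((h x hxψ).1 hx).eq_or_lt with h0 | h0
  · exact Or.inl ⟨hx, ψ, hψ, hxψ, h, h0.symm⟩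
  · right
    rw [mem_interior_iff_mem_nhds]
    have hc : ContinuousAt (fun y => (ψ y).im) x :=
      Complex.continuous_im.continuousAt.comp (ψ.continuousAt hxψ)
    filter_upwards [ψ.open_source.mem_nhds hxψ, hc.eventually (lt_mem_nhds h0)] with y hy1 hy2
    exact (h y hy1).2 hy2.le

/-- Moving from `ψ x` straight down in the straightening chart leaves `Y` at once. -/
lemma notMem_interior_of_mem_boundary {Y : Set X} {x : X} (hx : x ∈ boundary Y) :
    x ∉ interior Y := by
  obtain ⟨-, ψ, -, hxψ, h, h0⟩ := hx
  rw [mem_interior_iff_mem_nhds]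
  intro hY
  have hn := mem_nhds_chart hxψ (inter_mem hY (ψ.open_source.mem_nhds hxψ))
  have hc : Tendsto (fun t : ℝ => ψ x - t * Complex.I) (𝓝[>] 0) (𝓝 (ψ x)) := by
    have : Continuous fun t : ℝ => ψ x - t * Complex.I := by fun_prop
    simpa using (this.tendsto 0).mono_left nhdsWithin_le_nhds
  obtain ⟨t, ⟨ht1, ht2⟩, ht0⟩ := ((hc.eventually hn).and self_mem_nhdsWithin).exists
  have := (h _ ht2.2).1 ht2.1
  rw [ψ.right_inv ht1] at this
  simp only [Complex.sub_im, h0, Complex.mul_im, Complex.ofReal_re, Complex.I_im, mul_one,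
    Complex.ofReal_im, Complex.I_re, mul_zero, add_zero, zero_sub] at this
  have ht0 : 0 < t := ht0
  linarith

/-- In the holomorphic chart, `Y` is locally the set where the smooth function `Im ψ` is
non-negative, and its gradient does not vanish. The same description shows that `Y` is closed near
`p`, though it need not be closed in `X`. -/
lemma exists_exterior_disk_of_mem_boundary {Y : Set X} {p : X} (hp : p ∈ boundary Y) :
    ∃ a : ℂ, a ≠ chartAt ℂ p p ∧ ∃ R > 0, closedBall (chartAt ℂ p p) R ⊆ (chartAt ℂ p).target ∧
      IsClosed (closedBall (chartAt ℂ p p) R ∩ (chartAt ℂ p).symm ⁻¹' Y) ∧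
      ∀ z ∈ closedBall (chartAt ℂ p p) R, (chartAt ℂ p).symm z ∈ Y → z ≠ chartAt ℂ p p →
        ‖chartAt ℂ p p - a‖ < ‖z - a‖ := by
  obtain ⟨-, ψ, hψ, hpψ, h, h0⟩ := hp
  set φ := chartAt ℂ p with hφ
  have hpφ : p ∈ φ.source := mem_chart_source ℂ p
  have hcompat := hψ φ (chart_mem_atlas ℂ p)
  have c1 := (contDiffOn_transition hcompat.2).contDiffAt
    (mem_nhds_chart hpφ (ψ.open_source.mem_nhds hpψ))
  have c2 := (contDiffOn_transition hcompat.1).contDiffAt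
    (mem_nhds_chart hpψ (φ.open_source.mem_nhds hpφ))
  have hcd : ContDiffAt ℝ 2 (fun z => (ψ (φ.symm z)).im) (φ p) :=
    Complex.imCLM.contDiff.contDiffAt.comp (φ p) (mod_cast contDiffAt_infty.1 c1 2)
  obtain ⟨a, ha, R, hR, hext⟩ := exists_exterior_disk hcd (by simp [φ.left_inv hpφ, h0])
    (fderiv_im_transition_ne_zero hpφ hpψ (c1.differentiableAt (by simp))
      (c2.differentiableAt (by simp)))
  obtain ⟨r, hr0, hr⟩ := (eventually_closedBall_subset
    (inter_mem (mem_nhds_chart hpφ (ψ.open_source.mem_nhds hpψ)) (ball_mem_nhds (φ p) hR))).exists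
  refine ⟨a, ha, r, hr0, fun z hz => (hr hz).1.1, ?_, fun z hz hzY hne =>
    hext z (hr hz).2 ((h _ (hr hz).1.2).1 hzY) hne⟩
  have hc : ContinuousOn (fun z => (ψ (φ.symm z)).im) (closedBall (φ p) r) :=
    Complex.continuous_im.comp_continuousOn
      ((contDiffOn_transition hcompat.2).continuousOn.mono fun z hz => (hr hz).1)
  have e : closedBall (φ p) r ∩ φ.symm ⁻¹' Y =
      closedBall (φ p) r ∩ (fun z => (ψ (φ.symm z)).im) ⁻¹' Ici 0 := by
    ext z
    exact and_congr_right fun hz => h _ (hr hz).1.2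
  rw [e]
  exact hc.preimage_isClosed_of_isClosed isClosed_closedBall isClosed_Ici

/-- Barriers at the boundary points of a sub-manifold. -/
lemma exists_barrier {Y : Set X} {p : X} (hp : p ∈ boundary Y) {N : Set X} (hN : N ∈ 𝓝 p) (B : ℝ) :
    ∃ δ > 0, closedBall (chartAt ℂ p p) δ ⊆ (chartAt ℂ p).target ∩ (chartAt ℂ p).symm ⁻¹' N ∧
      IsCompact (closedBall (chartAt ℂ p p) δ ∩ (chartAt ℂ p).symm ⁻¹' Y) ∧
      ∃ h : ℂ → ℝ, h (chartAt ℂ p p) = 0 ∧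
        ∀ z ∈ closedBall (chartAt ℂ p p) δ ∩ (chartAt ℂ p).symm ⁻¹' Y,
          HarmonicAt h z ∧ 0 ≤ h z ∧ (z ∈ sphere (chartAt ℂ p p) δ → B ≤ h z) := by
  obtain ⟨a, ha, R, hR, hRt, hcl, hext⟩ := exists_exterior_disk_of_mem_boundary hp
  set φ := chartAt ℂ p with hφ
  have hpφ : p ∈ φ.source := mem_chart_source ℂ p
  obtain ⟨δ, hδ0, hδ⟩ := (eventually_closedBall_subset
    (inter_mem (mem_nhds_chart hpφ hN) (closedBall_mem_nhds (φ p) hR))).exists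
  have hδR : closedBall (φ p) δ ⊆ closedBall (φ p) R := fun z hz => (hδ hz).2
  have hK : IsCompact (closedBall (φ p) δ ∩ φ.symm ⁻¹' Y) := by
    have : closedBall (φ p) δ ∩ φ.symm ⁻¹' Y =
        closedBall (φ p) δ ∩ (closedBall (φ p) R ∩ φ.symm ⁻¹' Y) := by
      rw [← inter_assoc, inter_eq_left.2 hδR]
    rw [this]
    exact (isCompact_closedBall _ _).inter_right hcl
  have hpa : 0 < ‖φ p - a‖ := norm_pos_iff.2 (sub_ne_zero.2 ha.symm)
  -- The logarithmic potential of the exterior center: harmonic off `a`, zero at `φ p`, and positive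
  -- at the other points of `Y` in the disk.
  set w : ℂ → ℝ := fun z => Real.log ‖z - a‖ - Real.log ‖φ p - a‖ with hw
  have hle : ∀ z ∈ closedBall (φ p) δ ∩ φ.symm ⁻¹' Y, ‖φ p - a‖ ≤ ‖z - a‖ := by
    intro z hz
    by_cases hzp : z = φ p
    · rw [hzp]
    · exact (hext z (hδR hz.1) hz.2 hzp).le
  have hharm : ∀ z ∈ closedBall (φ p) δ ∩ φ.symm ⁻¹' Y, HarmonicAt w z := by
    intro z hz
    have hza : z - a ≠ 0 := norm_pos_iff.1 (hpa.trans_le (hle z hz))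
    have han : AnalyticAt ℂ (fun z : ℂ => z - a) z := by fun_prop
    exact (han.harmonicAt_log_norm hza).sub (harmonicAt_const _)
  have hnn : ∀ z ∈ closedBall (φ p) δ ∩ φ.symm ⁻¹' Y, 0 ≤ w z := fun z hz =>
    sub_nonneg.2 (Real.log_le_log hpa (hle z hz))
  -- Compactness gives a positive lower bound on the bounding circle; scaling `w` by `|B| / c` then
  -- lifts it to `B` there and keeps it non-negative.
  obtain ⟨c, hc0, hc⟩ : ∃ c > 0, ∀ z ∈ (closedBall (φ p) δ ∩ φ.symm ⁻¹' Y) ∩ sphere (φ p) δ,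
      c ≤ w z := by
    apply (hK.inter_right isClosed_sphere).exists_forall_le'
    · exact fun z hz => (hharm z hz.1).1.continuousAt.continuousWithinAt
    · intro z hz
      have hzp : z ≠ φ p := by
        rintro rfl
        have := hz.2
        rw [mem_sphere, dist_self] at this
        exact hδ0.ne this
      exact sub_pos.2 (Real.log_lt_log hpa (hext z (hδR hz.1.1) hz.1.2 hzp))
  refine ⟨δ, hδ0, fun z hz => (hδ hz).1, hK, (|B| / c) • w, by simp [hw], fun z hz =>
    ⟨(hharm z hz).const_smul, ?_, fun hzs => ?_⟩⟩
  · exact mul_nonneg (by positivity) (hnn z hz)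
  · calc B ≤ |B| := le_abs_self B
      _ = |B| / c * c := by field_simp
      _ ≤ |B| / c * w z := mul_le_mul_of_nonneg_left (hc z ⟨hz, hzs⟩) (by positivity)

end Submanifold

/-! ### Subsolutions and Dirichlet's principle. -/

section Dirichlet

variable {X : Type*} [TopologicalSpace X] [ChartedSpace ℂ X]

lemma IsSubmeanAt.congr {v w : ℂ → ℝ} {z : ℂ} (h : IsSubmeanAt v z) (hvw : v =ᶠ[𝓝 z] w) :
    IsSubmeanAt w z := by
  filter_upwards [h, eventually_closedBall_subset hvw] with r hr ⟨h0, hsub⟩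
  have e : circleAverage v z r = circleAverage w z r := by
    refine circleAverage_congr_sphere fun y hy => hsub ?_
    rw [abs_of_pos h0] at hy
    exact sphere_subset_closedBall hy
  rwa [← e, ← hvw.eq_of_nhds]

lemma IsSubharmonicAt.congr {u v : X → ℝ} {x : X} (h : IsSubharmonicAt u x) (huv : u =ᶠ[𝓝 x] v) :
    IsSubharmonicAt v x := fun φ hφ hx =>
  (h φ hφ hx).congr <| by
    filter_upwards [mem_nhds_chart hx huv] with z hz
    exact hz.2

/-- The Perron family of the Dirichlet problem on `Y` with boundary values `f`. -/
structure IsDirichletSubsolution (Y : Set X) (m M : ℝ) (f g : X → ℝ) : Prop where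
  continuousOn : ContinuousOn g Y
  subharmonic : IsSubharmonicOn g (interior Y)
  mem_Icc : ∀ x ∈ Y, g x ∈ Icc m M
  le_boundary : ∀ x ∈ boundary Y, g x ≤ f x

lemma IsDirichletSubsolution.max {Y : Set X} {m M : ℝ} {f g₁ g₂ : X → ℝ}
    (h₁ : IsDirichletSubsolution Y m M f g₁) (h₂ : IsDirichletSubsolution Y m M f g₂) :
    IsDirichletSubsolution Y m M f (fun x => max (g₁ x) (g₂ x)) where
  continuousOn := continuousOn_max h₁.continuousOn h₂.continuousOn
  subharmonic := h₁.subharmonic.max isOpen_interior h₂.subharmonic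
  mem_Icc x hx := ⟨le_max_of_le_left (h₁.mem_Icc x hx).1,
    max_le (h₁.mem_Icc x hx).2 (h₂.mem_Icc x hx).2⟩
  le_boundary x hx := max_le (h₁.le_boundary x hx) (h₂.le_boundary x hx)

/-- The disk chart lies in the interior of `Y`, so values on the boundary are untouched. -/
lemma IsDirichletSubsolution.poissonModification [T2Space X] {Y : Set X} {m M : ℝ} {f g : X → ℝ}
    (h : IsDirichletSubsolution Y m M f g) {φ : OpenPartialHomeomorph X ℂ} (hφ : IsDiskChart φ)
    (hφY : φ.source ⊆ interior Y) :
    IsDirichletSubsolution Y m M f (poissonModification φ g) where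
  continuousOn :=
    continuousOn_poissonModification hφ (hφY.trans interior_subset) h.continuousOn
  subharmonic := isSubharmonicOn_poissonModification isOpen_interior h.subharmonic hφ hφY
  mem_Icc _ hx :=
    poissonModification_mem_Icc hφ (hφY.trans interior_subset) h.continuousOn h.mem_Icc hx
  le_boundary x hx := by
    rw [poissonModification_of_notMem
      fun hd => notMem_interior_of_mem_boundary hx (hφY hd.1)]
    exact h.le_boundary x hx

lemma isDirichletSubsolution_const [IsManifold 𝓘(ℂ) 1 X] {Y : Set X} {m M : ℝ} (hmM : m ≤ M)
    {f : X → ℝ} (hf : ∀ x ∈ boundary Y, m ≤ f x) :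
    IsDirichletSubsolution Y m M f (fun _ => m) where
  continuousOn := continuousOn_const
  subharmonic := isSubharmonicOn_const m isOpen_interior
  mem_Icc _ _ := ⟨le_rfl, hmM⟩
  le_boundary := hf

lemma exists_nhds_forall_dist_boundary_le {Y : Set X} {f : X → ℝ} (hf : ContinuousOn f (boundary Y))
    {p : X} (hp : p ∈ boundary Y) {ε : ℝ} (hε : 0 < ε) :
    ∃ N ∈ 𝓝 p, ∀ x ∈ N, x ∈ boundary Y → |f x - f p| < ε := by
  have := Metric.tendsto_nhds.1 (hf p hp) ε hε
  rw [eventually_nhdsWithin_iff] at this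
  exact ⟨_, this, fun x hx hxb => hx hxb⟩

/-- Subsolutions are bounded above near a boundary point, uniformly. -/
lemma exists_nhds_forall_subsolution_le {Y : Set X} (hY : IsSubmanifoldWithBoundary Y) {m M : ℝ}
    {f : X → ℝ} (hf : ContinuousOn f (boundary Y)) (hfm : ∀ x ∈ boundary Y, f x ∈ Icc m M)
    [IsManifold 𝓘(ℂ) 1 X] {p : X} (hp : p ∈ boundary Y) {ε : ℝ} (hε : 0 < ε) :
    ∃ N ∈ 𝓝 p, ∀ g, IsDirichletSubsolution Y m M f g → ∀ x ∈ N, x ∈ Y → g x ≤ f p + ε := by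
  obtain ⟨N, hN, hfN⟩ := exists_nhds_forall_dist_boundary_le hf hp (half_pos hε)
  obtain ⟨δ, hδ, hsub, hK, h, hh0, hh⟩ := exists_barrier hp hN (M - m)
  set φ := chartAt ℂ p with hφ
  have hφA : φ ∈ IsManifold.maximalAtlas 𝓘(ℂ) 1 X := IsManifold.chart_mem_maximalAtlas p
  have hpφ : p ∈ φ.source := mem_chart_source ℂ p
  have hpK : φ p ∈ closedBall (φ p) δ ∩ φ.symm ⁻¹' Y :=
    ⟨mem_closedBall_self hδ.le, by rw [mem_preimage, φ.left_inv hpφ]; exact hp.1⟩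
  have hhc : ContinuousAt (fun x => h (φ x)) p :=
    (hh _ hpK).1.1.continuousAt.comp (φ.continuousAt hpφ)
  have hsmall : ∀ᶠ x in 𝓝 p, h (φ x) < ε / 2 :=
    hhc.eventually (gt_mem_nhds (by simp only [hh0]; exact half_pos hε))
  refine ⟨_, inter_mem (inter_mem (φ.open_source.mem_nhds hpφ)
    ((φ.continuousAt hpφ).preimage_mem_nhds (closedBall_mem_nhds _ hδ))) hsmall,
    fun g hg x ⟨⟨hxφ, hxb⟩, hxh⟩ hxY => ?_⟩
  -- Maximum principle for `g - h - f p - ε / 2` on the part of `Y` in the chart disk. Boundary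
  -- points of `Y` are handled by continuity of `f`; on the bounding circle `h ≥ M - m` gives `g ≤ M
  -- ≤ f p + h`; elsewhere the function is submean.
  have hkey := nonpos_of_isSubmeanAt hK
    (v := fun z => (g ∘ φ.symm) z - (h z + (f p + ε / 2))) ?_ ?_ (φ x)
    ⟨hxb, by rw [mem_preimage, φ.left_inv hxφ]; exact hxY⟩
  · simp only [Function.comp_apply, φ.left_inv hxφ] at hkey
    have hxh : h (φ x) < ε / 2 := hxh
    linarith
  · refine ((continuousOn_comp_symm hg.continuousOn).mono fun z hz => ⟨(hsub hz.1).1, hz.2⟩).sub ?_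
    exact ContinuousOn.add (fun z hz => (hh z hz).1.1.continuousAt.continuousWithinAt)
      continuousOn_const
  · intro z hz
    have hzt : z ∈ φ.target := (hsub hz.1).1
    obtain ⟨hzh, hz0, hzB⟩ := hh z hz
    have hgz := hg.mem_Icc _ hz.2
    rcases hY.mem_boundary_or_mem_interior hz.2 with hb | hi
    · left
      have h1 := hg.le_boundary _ hb
      have h2 := (abs_lt.1 (hfN _ (hsub hz.1).2 hb)).2
      simp only [Function.comp_apply]
      linarith
    · by_cases hzs : z ∈ sphere (φ p) δ
      · left
        have h1 := hzB hzs
        have h2 := (hfm p hp).1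
        have h3 := hgz.2
        simp only [Function.comp_apply]
        linarith
      · right
        have hzb : z ∈ ball (φ p) δ := by
          have := hz.1
          rw [← ball_union_sphere] at this
          exact this.resolve_right hzs
        have hni : φ.target ∩ φ.symm ⁻¹' interior Y ∈ 𝓝 z := by
          have := mem_nhds_chart (φ.map_target hzt) (isOpen_interior.mem_nhds hi)
          rwa [φ.right_inv hzt] at this
        refine ⟨inter_mem (mem_of_superset (isOpen_ball.mem_nhds hzb) ball_subset_closedBall)
          (mem_of_superset hni fun w hw => show φ.symm w ∈ Y from interior_subset hw.2), ?_⟩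
        have hs := hg.subharmonic.isSubharmonicAt isOpen_interior hi φ hφA (φ.map_target hzt)
        rw [φ.right_inv hzt] at hs
        exact hs.sub_harmonicAt hni (continuousOn_comp_symm hg.subharmonic.1)
          (hzh.add (harmonicAt_const _))

/-- Near a boundary point there is a subsolution almost attaining the boundary value. -/
lemma exists_subsolution_ge [T2Space X] [IsManifold 𝓘(ℂ) 1 X] {Y : Set X} {m M : ℝ}
    {f : X → ℝ} (hf : ContinuousOn f (boundary Y))
    (hfm : ∀ x ∈ boundary Y, f x ∈ Icc m M) {p : X} (hp : p ∈ boundary Y) {ε : ℝ} (hε : 0 < ε) :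
    ∃ N ∈ 𝓝 p, ∃ g, IsDirichletSubsolution Y m M f g ∧ ∀ x ∈ N, f p - ε ≤ g x := by
  classical
  have hmM : m ≤ M := (hfm p hp).1.trans (hfm p hp).2
  obtain ⟨N, hN, hfN⟩ := exists_nhds_forall_dist_boundary_le hf hp (half_pos hε)
  obtain ⟨δ, hδ, hsub, hK, h, hh0, hh⟩ := exists_barrier hp hN (M - m)
  set φ := chartAt ℂ p with hφ
  have hφA : φ ∈ IsManifold.maximalAtlas 𝓘(ℂ) 1 X := IsManifold.chart_mem_maximalAtlas p
  have hpφ : p ∈ φ.source := mem_chart_source ℂ p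
  have hpK : φ p ∈ closedBall (φ p) δ ∩ φ.symm ⁻¹' Y :=
    ⟨mem_closedBall_self hδ.le, by rw [mem_preimage, φ.left_inv hpφ]; exact hp.1⟩
  set q : X → ℝ := fun x => f p - ε / 2 - h (φ x) with hq
  -- The inverted barrier, cut off below by the constant subsolution `m` and continued by `m`
  -- outside the chart disk.
  set g : X → ℝ := fun x => if x ∈ φ.source ∧ φ x ∈ ball (φ p) δ then max m (q x) else m with hg
  have hgin : ∀ x ∈ φ.source, φ x ∈ ball (φ p) δ → g x = max m (q x) := fun x h1 h2 =>
    if_pos ⟨h1, h2⟩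
  have hgout : ∀ x, ¬(x ∈ φ.source ∧ φ x ∈ ball (φ p) δ) → g x = m := fun x hx => if_neg hx
  have hball : ∀ x ∈ φ.source, φ x ∈ ball (φ p) δ → {y | g y = max m (q y)} ∈ 𝓝 x := by
    intro x hx hxb
    filter_upwards [φ.open_source.mem_nhds hx,
      (φ.continuousAt hx).preimage_mem_nhds (isOpen_ball.mem_nhds hxb)] with y hy1 hy2
    exact hgin y hy1 hy2
  have hKmem : ∀ x ∈ Y, x ∈ φ.source → φ x ∈ closedBall (φ p) δ →
      φ x ∈ closedBall (φ p) δ ∩ φ.symm ⁻¹' Y := fun x hxY hx hxb =>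
    ⟨hxb, by rw [mem_preimage, φ.left_inv hx]; exact hxY⟩
  have hqc : ∀ x ∈ φ.source, HarmonicAt h (φ x) → ContinuousAt q x := fun x hx hhx =>
    continuousAt_const.sub (hhx.1.continuousAt.comp (φ.continuousAt hx))
  have hloc : ∀ x ∈ Y, ContinuousAt g x ∧ IsSubharmonicAt g x := by
    have hconst : ∀ x, g =ᶠ[𝓝 x] (fun _ => m) → ContinuousAt g x ∧ IsSubharmonicAt g x :=
      fun x hx => ⟨continuousAt_const.congr hx.symm, (isSubharmonicAt_const m x).congr hx.symm⟩
    intro x hxY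
    by_cases hxK : x ∈ φ.symm '' closedBall (φ p) δ
    · obtain ⟨z, hz, rfl⟩ := hxK
      have hzt := (hsub hz).1
      have hxs := φ.map_target hzt
      obtain ⟨hzh, hz0, hzB⟩ := hh z ⟨hz, hxY⟩
      have hzh' : HarmonicAt h (φ (φ.symm z)) := by rwa [φ.right_inv hzt]
      by_cases hzs : z ∈ sphere (φ p) δ
      · apply hconst
        -- The choice `B = M - m` together with the extra `ε / 2` makes this strict, so `g` is
        -- constant near the bounding circle and the two pieces glue.
        have hlt : q (φ.symm z) < m := by
          have := hzB hzs
          have := (hfm p hp).2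
          simp only [hq, φ.right_inv hzt]
          linarith
        filter_upwards [(hqc _ hxs hzh').eventually (gt_mem_nhds hlt)] with y hy
        by_cases hyb : y ∈ φ.source ∧ φ y ∈ ball (φ p) δ
        · rw [hgin y hyb.1 hyb.2, max_eq_left hy.le]
        · exact hgout y hyb
      · have hzb : φ (φ.symm z) ∈ ball (φ p) δ := by
          rw [φ.right_inv hzt]
          rw [← ball_union_sphere] at hz
          exact hz.resolve_right hzs
        have heq : (fun y => max m (q y)) =ᶠ[𝓝 (φ.symm z)] g := by
          filter_upwards [hball _ hxs hzb] with y hy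
          exact hy.symm
        have hW : φ.source ∩ φ ⁻¹' {w | HarmonicAt h w} ∈ 𝓝 (φ.symm z) :=
          inter_mem (φ.open_source.mem_nhds hxs)
            ((φ.continuousAt hxs).preimage_mem_nhds hzh'.eventually)
        have hqW : ContinuousOn q (φ.source ∩ φ ⁻¹' {w | HarmonicAt h w}) := fun y hy =>
          (hqc y hy.1 hy.2).continuousWithinAt
        have hqs : IsSubharmonicAt q (φ.symm z) := by
          refine IsSubharmonicAt.of_harmonicAt hφA hxs ((harmonicAt_congr_nhds ?_).1
            ((harmonicAt_const (f p - ε / 2)).sub hzh'))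
          filter_upwards [φ.open_target.mem_nhds (φ.map_source hxs)] with w hw
          simp [hq, φ.right_inv hw]
        have hms : IsSubharmonicAt (fun y => Max.max m (q y)) (φ.symm z) :=
          (isSubharmonicAt_const m _).max hW continuousOn_const hqW hqs
        exact ⟨ContinuousAt.congr (continuousAt_const.max (hqc _ hxs hzh')) heq, hms.congr heq⟩
    · have hcl : IsClosed (φ.symm '' closedBall (φ p) δ) :=
        ((isCompact_closedBall _ _).image_of_continuousOn
          (φ.continuousOn_symm.mono fun z hz => (hsub hz).1)).isClosed
      apply hconst
      filter_upwards [hcl.isOpen_compl.mem_nhds hxK] with y hy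
      exact hgout y fun hyb => hy ⟨φ y, ball_subset_closedBall hyb.2, φ.left_inv hyb.1⟩
  refine ⟨_, inter_mem (inter_mem (φ.open_source.mem_nhds hpφ)
    ((φ.continuousAt hpφ).preimage_mem_nhds (isOpen_ball.mem_nhds (mem_ball_self hδ))))
    ((hqc p hpφ (hh _ hpK).1).eventually (lt_mem_nhds (a := f p - ε) ?_)), g,
    ⟨fun x hx => (hloc x hx).1.continuousWithinAt, ?_, ?_, ?_⟩, ?_⟩
  · simp only [hq, hh0]
    linarith
  · exact (isSubharmonicOn_iff isOpen_interior).2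
      ⟨fun x hx => (hloc x (interior_subset hx)).1.continuousWithinAt,
        fun x hx => (hloc x (interior_subset hx)).2⟩
  · intro x hx
    by_cases hxb : x ∈ φ.source ∧ φ x ∈ ball (φ p) δ
    · rw [hgin x hxb.1 hxb.2]
      have h1 := (hh _ (hKmem x hx hxb.1 (ball_subset_closedBall hxb.2))).2.1
      have h2 := (hfm p hp).2
      refine ⟨le_max_left _ _, max_le hmM ?_⟩
      simp only [hq]
      linarith
    · rw [hgout x hxb]
      exact ⟨le_rfl, hmM⟩
  · intro x hx
    by_cases hxb : x ∈ φ.source ∧ φ x ∈ ball (φ p) δ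
    · rw [hgin x hxb.1 hxb.2]
      have h1 := (hh _ (hKmem x hx.1 hxb.1 (ball_subset_closedBall hxb.2))).2.1
      have h2 := (hsub (ball_subset_closedBall hxb.2)).2
      rw [mem_preimage, φ.left_inv hxb.1] at h2
      have h3 := (abs_lt.1 (hfN x h2 hx)).1
      refine max_le (hfm x hx).1 ?_
      simp only [hq]
      linarith
    · rw [hgout x hxb]
      exact (hfm x hx).1
  · rintro x ⟨⟨hx1, hx2⟩, hx3⟩
    rw [hgin x hx1 hx2]
    exact (le_of_lt hx3).trans (le_max_right _ _)

lemma IsHarmonicOn.congr {u v : X → ℝ} {U : Set X} (hu : IsHarmonicOn u U) (h : EqOn u v U) :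
    IsHarmonicOn v U := by
  refine ⟨hu.1.congr h.symm, fun φ hφ hφU => ?_⟩
  have hmem : ∀ z ∈ closedBall (0 : ℂ) 1, u (φ.symm z) = v (φ.symm z) := fun z hz =>
    h (hφU (φ.map_target (hφ.2 hz)))
  have e : circleAverage (u ∘ φ.symm) 0 1 = circleAverage (v ∘ φ.symm) 0 1 := by
    refine circleAverage_congr_sphere fun z hz => hmem z (sphere_subset_closedBall ?_)
    rwa [abs_one] at hz
  rw [← e, ← hmem 0 (mem_closedBall_self zero_le_one)]
  exact hu.2 φ hφ hφU

/-- **Dirichlet's principle**, for boundary values given by a function on the whole surface. -/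
theorem dirichlet_principle [T2Space X] [IsManifold 𝓘(ℂ) 1 X] {Y : Set X}
    (hY : IsSubmanifoldWithBoundary Y) {m M : ℝ} (hmM : m ≤ M) {f : X → ℝ}
    (hf : ContinuousOn f (boundary Y)) (hfm : ∀ x ∈ boundary Y, f x ∈ Icc m M) :
    ∃ F : X → ℝ, ContinuousOn F Y ∧ (∀ x ∈ Y, F x ∈ Icc m M) ∧ EqOn F f (boundary Y) ∧
      IsHarmonicOn F (interior Y) := by
  classical
  set G : Set (X → ℝ) := {g | IsDirichletSubsolution Y m M f g} with hG
  set u : X → ℝ := fun x => sSup ((fun g : X → ℝ => g x) '' G) with hu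
  have hmG : (fun _ : X => m) ∈ G := isDirichletSubsolution_const hmM fun x hx => (hfm x hx).1
  have hlub : ∀ x ∈ Y, IsLUB ((fun g : X → ℝ => g x) '' G) (u x) := by
    refine fun x hx => isLUB_csSup (Set.Nonempty.image _ ⟨_, hmG⟩) ⟨M, ?_⟩
    rintro _ ⟨g, hg, rfl⟩
    exact (hg.mem_Icc x hx).2
  have huIcc : ∀ x ∈ Y, u x ∈ Icc m M := by
    refine fun x hx => ⟨(hlub x hx).1 ⟨_, hmG, rfl⟩, (hlub x hx).2 ?_⟩
    rintro _ ⟨g, hg, rfl⟩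
    exact (hg.mem_Icc x hx).2
  have hharm : IsHarmonicOn u (interior Y) :=
    isHarmonicOn_of_isLUB isOpen_interior (fun g hg => hg.subharmonic)
      (fun g₁ h₁ g₂ h₂ => h₁.max h₂) (fun g hg φ hφ hφY => hg.poissonModification hφ hφY)
      fun x hx => hlub x (interior_subset hx)
  -- Prescribing `f` on the boundary makes the extension property immediate and leaves `u` unchanged
  -- on the interior; only continuity at the boundary remains.
  set F : X → ℝ := fun x => if x ∈ boundary Y then f x else u x with hF
  have hFb : ∀ x ∈ boundary Y, F x = f x := fun x hx => if_pos hx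
  have hFu : ∀ x, x ∉ boundary Y → F x = u x := fun x hx => if_neg hx
  have hFi : EqOn u F (interior Y) := fun x hx =>
    (hFu x fun hb => notMem_interior_of_mem_boundary hb hx).symm
  refine ⟨F, fun p hp => ?_, fun x hx => ?_, hFb, hharm.congr hFi⟩
  · rcases hY.mem_boundary_or_mem_interior hp with hpb | hpi
    · refine Metric.tendsto_nhds.2 fun ε hε => ?_
      rw [hFb p hpb, eventually_nhdsWithin_iff]
      obtain ⟨N₁, hN₁, h₁⟩ := exists_nhds_forall_dist_boundary_le hf hpb hε
      obtain ⟨N₂, hN₂, h₂⟩ := exists_nhds_forall_subsolution_le hY hf hfm hpb (half_pos hε)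
      obtain ⟨N₃, hN₃, g, hg, h₃⟩ := exists_subsolution_ge hf hfm hpb (half_pos hε)
      -- Off the boundary, `u` is squeezed between the near-optimal subsolution `g` and the uniform
      -- upper bound for all subsolutions.
      filter_upwards [hN₁, hN₂, hN₃] with x hx₁ hx₂ hx₃ hxY
      rw [Real.dist_eq]
      by_cases hxb : x ∈ boundary Y
      · rw [hFb x hxb]
        exact h₁ x hx₁ hxb
      · rw [hFu x hxb, abs_lt]
        have hle : u x ≤ f p + ε / 2 := by
          refine (hlub x hxY).2 ?_
          rintro _ ⟨g, hg, rfl⟩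
          exact h₂ g hg x hx₂ hxY
        have hge : g x ≤ u x := (hlub x hxY).1 ⟨g, hg, rfl⟩
        have := h₃ x hx₃
        constructor <;> linarith
    · have hn := isOpen_interior.mem_nhds hpi
      exact ((hharm.1.congr hFi.symm).continuousAt hn).continuousWithinAt
  · by_cases hxb : x ∈ boundary Y
    · rw [hFb x hxb]
      exact hfm x hxb
    · rw [hFu x hxb]
      exact huIcc x hx

end Dirichlet

end RiemannSurface

end

theorem mainTheorem5 {X : Type*} [TopologicalSpace X] [T2Space X] [ConnectedSpace X]
    [ChartedSpace ℂ X] [IsManifold 𝓘(ℂ) 1 X] :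
    (∀ F : Set (X → ℝ), F.Nonempty → RiemannSurface.IsPerronFamily F →
      RiemannSurface.IsLocallyBoundedAbove F →
      ∃ u : X → ℝ, (∀ x : X, IsLUB ((fun f : X → ℝ => f x) '' F) (u x)) ∧
        RiemannSurface.IsHarmonic u) ∧
    (∀ Y : Set X, RiemannSurface.IsSubmanifoldWithBoundary Y →
      ∀ m M : ℝ, m ≤ M → ∀ f : RiemannSurface.boundary Y → ℝ, Continuous f →
      (∀ x, f x ∈ Set.Icc m M) →
      ∃ F : X → ℝ, ContinuousOn F Y ∧ (∀ x ∈ Y, F x ∈ Set.Icc m M) ∧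
        (∀ x : RiemannSurface.boundary Y, F x = f x) ∧
        RiemannSurface.IsHarmonicOn F (interior Y)) := by
  refine ⟨fun F hne hF hb => RiemannSurface.perron_principle hne hF hb,
    fun Y hY m M hmM f hf hfm => ?_⟩
  -- The default value `m` off the boundary is immaterial: the subsolutions and the conclusion see
  -- `f` only on the boundary.
  have hext : ∀ x : RiemannSurface.boundary Y,
      Function.extend Subtype.val f (fun _ => m) x = f x := fun x =>
    Subtype.val_injective.extend_apply _ _ x
  obtain ⟨F, h1, h2, h3, h4⟩ := RiemannSurface.dirichlet_principle hY hmM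
    (f := Function.extend Subtype.val f fun _ => m)
    (continuousOn_iff_continuous_domRestrict.2 (hf.congr fun x => (hext x).symm))
    (fun x hx => by rw [hext ⟨x, hx⟩]; exact hfm ⟨x, hx⟩)
  exact ⟨F, h1, h2, fun x => (h3 x.2).trans (hext x), h4⟩
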